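/- All schemes are over $\mathbb{C}$. For a natural number $a \ge 0$ and a field $K \supseteq \mathbb{C}$ let $\mathbb{F}_{a,K} = \mathbb{P}(\mathcal{O} \oplus \mathcal{O}(a))$ be the $a$-th Hirzebruch surface over $K$, a $\mathbb{P}^1$-bundle over $\mathbb{P}^1_K$, and write $\mathbb{F}_a = \mathbb{F}_{a,\mathbb{C}}$. A smooth family of surfaces over $\mathbb{A}^1 = \operatorname{Spec} \mathbb{C}[t]$ is a proper morphism $\pi : \mathcal{F} \to \mathbb{A}^1$ that is smooth of relative dimension two. Let $n \ge 0$ be a natural number. There is a smooth family of surfaces $\mathcal{F} \to \mathbb{A}^1$ whose fibre over the point $0$ is isomorphic to $\mathbb{F}_{2n}$ and whose fibre over every other closed point is isomorphic to $\mathbb{F}_0$. More generally, for every extension field $K$ of $\mathbb{C}$ and every $K$-valued point $t = c$ of $\mathbb{A}^1$ with $c \neq 0$, the fibre over $c$ is isomorphic over $K$ to $\mathbb{F}_{0,K}$. Similarly, there is a smooth family of surfaces over $\mathbb{A}^1$ whose fibre over $0$ is isomorphic to $\mathbb{F}_{2n+1}$ and whose fibre over every other point (closed or not; indeed over every $K$-valued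 point $c \neq 0$, for every extension field $K$ of $\mathbb{C}$) is isomorphic over $K$ to $\mathbb{F}_{1,K}$. -/

import Mathlib

open AlgebraicGeometry CategoryTheory Limits
open scoped Polynomial LaurentPolynomial HomogeneousIdeal

universe u

attribute [local instance] MvPolynomial.gradedAlgebra

noncomputable section

namespace ProjLine

variable {R S T : Type u} [CommRing R] [CommRing S] [CommRing T]

/-- The grading of `R[x₀, x₁]` by total degree. -/
abbrev grading (R : Type u) [CommRing R] : ℕ → Submodule R (MvPolynomial (Fin 2) R) :=
  MvPolynomial.homogeneousSubmodule (Fin 2) R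

lemma X_mem (R : Type u) [CommRing R] (i : Fin 2) :
    (MvPolynomial.X i : MvPolynomial (Fin 2) R) ∈ grading R 1 :=
  MvPolynomial.isHomogeneous_X R i

lemma C_mem (r : R) : (MvPolynomial.C r : MvPolynomial (Fin 2) R) ∈ grading R 0 :=
  MvPolynomial.isHomogeneous_C _ r

lemma C_mem_smul (r : R) :
    (MvPolynomial.C r : MvPolynomial (Fin 2) R) ∈ grading R (0 • 1) :=
  MvPolynomial.isHomogeneous_C _ r

/-- The graded ring homomorphism `R[x₀, x₁] → S[x₀, x₁]` which is `φ` on coefficients and sends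
`x₀ ↦ x₀`, `x₁ ↦ w x₁`, for a unit `w` of `S`. -/
def subst (φ : R →+* S) (w : Sˣ) : grading R →+*ᵍ grading S where
  toRingHom := MvPolynomial.eval₂Hom (MvPolynomial.C.comp φ)
    ![MvPolynomial.X 0, MvPolynomial.C (w : S) * MvPolynomial.X 1]
  map_mem {i p} hp := by
    rw [MvPolynomial.mem_homogeneousSubmodule] at hp ⊢
    have := MvPolynomial.IsHomogeneous.eval₂ (n := 1) hp
      (MvPolynomial.C.comp φ : R →+* MvPolynomial (Fin 2) S) ![MvPolynomial.X 0, MvPolynomial.C (w : S) * MvPolynomial.X 1] (fun r => MvPolynomial.isHomogeneous_C _ _)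
      (fun j => by
        fin_cases j
        · exact MvPolynomial.isHomogeneous_X _ _
        · exact (MvPolynomial.isHomogeneous_X _ _).C_mul _)
    simpa using this

@[simp] lemma subst_C (φ : R →+* S) (w : Sˣ) (r : R) :
    subst φ w (MvPolynomial.C r) = MvPolynomial.C (φ r) := by
  change MvPolynomial.eval₂Hom _ _ _ = _
  simp

@[simp] lemma subst_X0 (φ : R →+* S) (w : Sˣ) :
    subst φ w (MvPolynomial.X 0) = MvPolynomial.X 0 := by
  change MvPolynomial.eval₂Hom _ _ _ = _
  simp

@[simp] lemma subst_X1 (φ : R →+* S) (w : Sˣ) :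
    subst φ w (MvPolynomial.X 1) = MvPolynomial.C (w : S) * MvPolynomial.X 1 := by
  change MvPolynomial.eval₂Hom _ _ _ = _
  simp

lemma gradedHom_ext {f g : grading R →+*ᵍ grading S}
    (hC : ∀ r, f (MvPolynomial.C r) = g (MvPolynomial.C r))
    (h0 : f (MvPolynomial.X 0) = g (MvPolynomial.X 0))
    (h1 : f (MvPolynomial.X 1) = g (MvPolynomial.X 1)) : f = g := by
  have : f.toRingHom = g.toRingHom := by
    refine MvPolynomial.ringHom_ext hC fun i => ?_
    fin_cases i
    · exact h0
    · exact h1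
  exact DFunLike.ext _ _ fun x => DFunLike.congr_fun this x

lemma subst_comp (φ : R →+* S) (v : Sˣ) (ψ : S →+* T) (w : Tˣ) :
    (subst ψ w).comp (subst φ v) = subst (ψ.comp φ) (Units.map ψ v * w) := by
  apply gradedHom_ext <;> simp [mul_assoc]

lemma subst_id : subst (RingHom.id R) 1 = GradedRingHom.id (grading R) := by
  apply gradedHom_ext <;> simp

lemma irrelevant_le_span (R : Type u) [CommRing R] :
    (HomogeneousIdeal.irrelevant (grading R)).toIdeal ≤
      Ideal.span (Set.range (MvPolynomial.X : Fin 2 → MvPolynomial (Fin 2) R)) := by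
  rw [HomogeneousIdeal.toIdeal_irrelevant_le]
  intro i hi p hp
  change p ∈ Ideal.span _
  rw [← Set.image_univ, MvPolynomial.mem_ideal_span_X_image]
  intro m hm
  have h1 := hp (MvPolynomial.mem_support_iff.mp hm)
  by_contra hcon
  push Not at hcon
  have : m = 0 := by ext j; simpa using hcon j
  subst this
  simp at h1
  omega

lemma irrelevant_le (φ : R →+* S) (w : Sˣ) :
    (grading S)₊ ≤ (grading R)₊.map (subst φ w) := by
  change (HomogeneousIdeal.irrelevant (grading S)).toIdeal ≤ _
  refine (irrelevant_le_span S).trans ?_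
  rw [Ideal.span_le]
  have hX (j : Fin 2) : subst φ w (MvPolynomial.X j) ∈
      ((grading R)₊.map (subst φ w)).toIdeal :=
    Ideal.mem_map_of_mem _ (HomogeneousIdeal.mem_irrelevant_of_mem (grading R) one_pos
      (X_mem R j))
  rintro _ ⟨j, rfl⟩
  fin_cases j
  · simpa using hX 0
  · have := Ideal.mul_mem_left _ (MvPolynomial.C ((w⁻¹ : Sˣ) : S)) (hX 1)
    rwa [subst_X1, ← mul_assoc, ← MvPolynomial.C_mul, Units.inv_mul, MvPolynomial.C_1,
      one_mul] at this

end ProjLine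

/-- The projective line `ℙ¹_R = Proj R[x₀, x₁]` over a commutative ring `R`. -/
abbrev ProjLine (R : Type u) [CommRing R] : Scheme.{u} := Proj (ProjLine.grading R)

namespace ProjLine

variable {R S T : Type u} [CommRing R] [CommRing S] [CommRing T]

/-- The structure morphism `ℙ¹_R → Spec R`. -/
def toSpec (R : Type u) [CommRing R] : ProjLine R ⟶ Spec (.of R) :=
  Proj.toSpecZero (grading R) ≫ Spec.map (CommRingCat.ofHom (algebraMap R (grading R 0)))

/-- The cover of `ℙ¹_R` by its two standard affine charts. -/
def cover (R : Type u) [CommRing R] : (ProjLine R).AffineOpenCover :=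
  Proj.affineOpenCoverOfIrrelevantLESpan (grading R) (MvPolynomial.X : Fin 2 → _)
    (m := fun _ => 1) (X_mem R) (fun _ => one_pos) (irrelevant_le_span R)

/-- The morphism `ℙ¹_S → ℙ¹_R` over `Spec φ : Spec S → Spec R` which is
`[x₀ : x₁] ↦ [x₀ : w x₁]` in homogeneous coordinates, for a unit `w` of `S`. -/
def map (φ : R →+* S) (w : Sˣ) : ProjLine S ⟶ ProjLine R :=
  Proj.map (subst φ w) (irrelevant_le φ w)

lemma map_comp (φ : R →+* S) (v : Sˣ) (ψ : S →+* T) (w : Tˣ) :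
    map (ψ.comp φ) (Units.map ψ v * w) = map ψ w ≫ map φ v := by
  unfold map
  rw [← Proj.map_comp]
  congr 1
  exact (subst_comp ..).symm

lemma map_id : map (RingHom.id R) 1 = 𝟙 (ProjLine R) := by
  unfold map
  refine Eq.trans ?_ (Proj.map_id (𝒜 := grading R))
  congr 1
  exact subst_id

lemma away_map_comp_algebraMap (φ : R →+* S) (w : Sˣ) (p : MvPolynomial (Fin 2) R) :
    ((HomogeneousLocalization.Away.map (subst φ w) p).comp
      (HomogeneousLocalization.fromZeroRingHom (grading R) (Submonoid.powers p))).comp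
        (algebraMap R (grading R 0)) =
    ((HomogeneousLocalization.fromZeroRingHom (grading S) (Submonoid.powers (subst φ w p))).comp
        (algebraMap S (grading S 0))).comp φ := by
  ext r
  simp only [RingHom.comp_apply]
  change HomogeneousLocalization.val (HomogeneousLocalization.map _ _
    (HomogeneousLocalization.mk _)) = HomogeneousLocalization.val (HomogeneousLocalization.mk _)
  rw [HomogeneousLocalization.map_mk, HomogeneousLocalization.val_mk,
    HomogeneousLocalization.val_mk]
  congr 1
  · exact subst_C φ w r
  · exact Subtype.ext (map_one (subst φ w))

lemma awayι_map_toSpec (φ : R →+* S) (w : Sˣ) {k : ℕ} (hk : 0 < k) (p : MvPolynomial (Fin 2) R)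
    (hp : p ∈ grading R k) :
    Proj.awayι (grading S) (subst φ w p) (Graded.map_mem (subst φ w) hp) hk ≫ map φ w ≫ toSpec R =
      Proj.awayι (grading S) (subst φ w p) (Graded.map_mem (subst φ w) hp) hk ≫
        toSpec S ≫ Spec.map (CommRingCat.ofHom φ) := by
  rw [map, toSpec, toSpec, Category.assoc, Proj.awayι_comp_map_assoc _ _ hk _ hp,
    Proj.awayι_toSpecZero_assoc, Proj.awayι_toSpecZero_assoc, ← Spec.map_comp, ← Spec.map_comp,
    ← Spec.map_comp, ← Spec.map_comp]
  exact congrArg (fun g => Spec.map (CommRingCat.ofHom g)) (away_map_comp_algebraMap φ w p)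

lemma map_toSpec (φ : R →+* S) (w : Sˣ) :
    map φ w ≫ toSpec R = toSpec S ≫ Spec.map (CommRingCat.ofHom φ) :=
  (Proj.mapAffineOpenCover _ (irrelevant_le φ w)).openCover.hom_ext _ _ fun s =>
    awayι_map_toSpec φ w s.1.2 _ s.2.2

lemma exists_smul_eq [Algebra R S] (f : R) [IsLocalization.Away f S] {n : ℕ}
    (b : MvPolynomial (Fin 2) S) (hb : b ∈ grading S n) :
    ∃ (N : ℕ) (a : MvPolynomial (Fin 2) R), a ∈ grading R n ∧
      MvPolynomial.map (algebraMap R S) a = MvPolynomial.C (algebraMap R S f) ^ N * b := by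
  let := MvPolynomial.algebraMvPolynomial (σ := Fin 2) (R := R) (S := S)
  obtain ⟨⟨a, ⟨_, _, ⟨N, rfl⟩, rfl⟩⟩, h⟩ := IsLocalization.surj
    ((Submonoid.powers f).map (MvPolynomial.C (σ := Fin 2))) b
  simp only [MvPolynomial.algebraMap_def, MvPolynomial.map_C, map_pow] at h
  refine ⟨N, MvPolynomial.homogeneousComponent n a,
    MvPolynomial.homogeneousComponent_isHomogeneous n a, ?_⟩
  rw [mul_comm, h]
  ext m
  have hm := congr(MvPolynomial.coeff m $h)
  rw [← map_pow, mul_comm, MvPolynomial.coeff_C_mul, MvPolynomial.coeff_map] at hm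
  rw [MvPolynomial.coeff_map, MvPolynomial.coeff_map, MvPolynomial.coeff_homogeneousComponent]
  split_ifs with hd
  · rfl
  · rw [← hm, map_zero, MvPolynomial.IsHomogeneous.coeff_eq_zero hb hd, mul_zero]

lemma exists_mul_eq [Algebra R S] (f : R) [IsLocalization.Away f S]
    (a b : MvPolynomial (Fin 2) R)
    (h : MvPolynomial.map (algebraMap R S) a = MvPolynomial.map (algebraMap R S) b) :
    ∃ (N : ℕ), MvPolynomial.C f ^ N * a = MvPolynomial.C f ^ N * b := by
  let := MvPolynomial.algebraMvPolynomial (σ := Fin 2) (R := R) (S := S)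
  obtain ⟨⟨_, _, ⟨N, rfl⟩, rfl⟩, h⟩ := IsLocalization.exists_of_eq
    (M := (Submonoid.powers f).map (MvPolynomial.C (σ := Fin 2))) (S := MvPolynomial (Fin 2) S) h
  exact ⟨N, by simpa using h⟩

lemma subst_one (φ : R →+* S) (p : MvPolynomial (Fin 2) R) :
    subst φ 1 p = MvPolynomial.map φ p := by
  have : (subst φ 1).toRingHom = MvPolynomial.map φ := by
    refine MvPolynomial.ringHom_ext (fun r => ?_) fun i => ?_
    · exact (subst_C φ 1 r).trans (MvPolynomial.map_C φ r).symm
    · rw [MvPolynomial.map_X]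
      fin_cases i
      · exact subst_X0 φ 1
      · exact (subst_X1 φ 1).trans (by simp)
  exact DFunLike.congr_fun this p

lemma isLocalization_away [Algebra R S] (f : R) [IsLocalization.Away f S] (i : Fin 2) :
    letI := (HomogeneousLocalization.Away.map (subst (algebraMap R S) 1)
      (MvPolynomial.X i)).toAlgebra
    IsLocalization.Away (HomogeneousLocalization.Away.mk (grading R)
      (X_mem R i) 0 (MvPolynomial.C f) (C_mem_smul f))
      (HomogeneousLocalization.Away (grading S)
        (subst (algebraMap R S) 1 (MvPolynomial.X i))) := by
  let := (HomogeneousLocalization.Away.map (subst (algebraMap R S) 1)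
      (MvPolynomial.X (R := R) i)).toAlgebra
  have hX := Graded.map_mem (subst (algebraMap R S) 1) (X_mem R i)
  refine IsLocalization.Away.mk _ ?_ ?_ ?_
  · rw [RingHom.algebraMap_toAlgebra, HomogeneousLocalization.Away.map_mk]
    obtain ⟨u, hu⟩ := IsLocalization.Away.algebraMap_isUnit (S := S) f
    refine IsUnit.of_mul_eq_one (HomogeneousLocalization.Away.mk (grading S) hX 0
      (MvPolynomial.C ((u⁻¹ : Sˣ) : S)) (C_mem_smul _)) ?_
    ext
    simp only [HomogeneousLocalization.val_mul, HomogeneousLocalization.val_one,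
      HomogeneousLocalization.Away.val_mk, Localization.mk_mul]
    rw [← Localization.mk_one, Localization.mk_eq_mk_iff, Localization.r_iff_exists]
    refine ⟨1, ?_⟩
    rw [subst_C, ← hu, ← MvPolynomial.C_mul]
    simp
  · intro z
    obtain ⟨n, b, hb, rfl⟩ := HomogeneousLocalization.Away.mk_surjective (grading S) hX z
    obtain ⟨N, a, ha, h⟩ := exists_smul_eq f b hb
    refine ⟨N, HomogeneousLocalization.Away.mk (grading R) (X_mem R i) n a ha, ?_⟩
    ext
    simp only [RingHom.algebraMap_toAlgebra, HomogeneousLocalization.Away.map_mk,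
      HomogeneousLocalization.val_mul, HomogeneousLocalization.val_pow,
      HomogeneousLocalization.Away.val_mk, Localization.mk_pow, Localization.mk_mul]
    rw [Localization.mk_eq_mk_iff, Localization.r_iff_exists]
    refine ⟨1, ?_⟩
    rw [subst_one _ a, subst_C, h]
    simp only [OneMemClass.coe_one, one_mul, Submonoid.coe_mul, SubmonoidClass.coe_pow, pow_zero,
      one_pow]
    ring
  · intro a b e
    obtain ⟨n, a, ha, rfl⟩ := HomogeneousLocalization.Away.mk_surjective (grading R) (X_mem R i) a
    obtain ⟨m, b, hb, rfl⟩ := HomogeneousLocalization.Away.mk_surjective (grading R) (X_mem R i) b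
    replace e := congr_arg HomogeneousLocalization.val e
    simp only [RingHom.algebraMap_toAlgebra, HomogeneousLocalization.Away.map_mk,
      HomogeneousLocalization.Away.val_mk,
      Localization.mk_eq_mk_iff, Localization.r_iff_exists] at e
    obtain ⟨⟨_, k, rfl⟩, hc⟩ := e
    simp only [← map_pow, ← map_mul] at hc
    rw [subst_one, subst_one] at hc
    obtain ⟨N, hN⟩ := exists_mul_eq f _ _ hc
    refine ⟨N, ?_⟩
    ext
    simp only [HomogeneousLocalization.val_mul, HomogeneousLocalization.val_pow,
      HomogeneousLocalization.Away.val_mk, Localization.mk_pow, Localization.mk_mul,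
      Localization.mk_eq_mk_iff, Localization.r_iff_exists]
    refine ⟨⟨_, k, rfl⟩, ?_⟩
    simp only [Submonoid.coe_mul, SubmonoidClass.coe_pow, pow_zero, one_pow, one_mul]
    linear_combination hN

lemma isPullback_awayι (φ : R →+* S) (w : Sˣ) (i : Fin 2) :
    IsPullback
      (Spec.map (CommRingCat.ofHom (HomogeneousLocalization.Away.map (subst φ w)
        (MvPolynomial.X (R := R) i))))
      (Proj.awayι (grading S) (subst φ w (MvPolynomial.X i))
        (Graded.map_mem (subst φ w) (X_mem R i)) one_pos)
      (Proj.awayι (grading R) (MvPolynomial.X i) (X_mem R i) one_pos)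
      (map φ w) := by
  refine IsOpenImmersion.isPullback _ _ _ _ ?_ ?_
  · exact Proj.awayι_comp_map (subst φ w) (irrelevant_le _ w) one_pos
        (MvPolynomial.X i) (X_mem R i)
  · rw [Proj.opensRange_awayι, Proj.opensRange_awayι]
    rfl

lemma isOpenImmersion_map_one [Algebra R S] (f : R) [IsLocalization.Away f S] :
    IsOpenImmersion (map (algebraMap R S) 1) := by
  refine IsZariskiLocalAtTarget.of_openCover (P := @IsOpenImmersion) (cover R).openCover fun i => ?_
  change Fin 2 at i
  let := (HomogeneousLocalization.Away.map (subst (algebraMap R S) 1)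
      (MvPolynomial.X (R := R) i)).toAlgebra
  have := isLocalization_away (S := S) f i
  have h2 := IsOpenImmersion.of_isLocalization (S := HomogeneousLocalization.Away (grading S)
        (subst (algebraMap R S) 1 (MvPolynomial.X i))) (HomogeneousLocalization.Away.mk (grading R)
      (X_mem R i) 0 (MvPolynomial.C f) (C_mem_smul f))
  have e := (isPullback_awayι (algebraMap R S) 1 i).flip.isoPullback_inv_snd
  change IsOpenImmersion (pullback.snd _ (Proj.awayι (grading R) (MvPolynomial.X i) (X_mem R i) one_pos))
  rw [← e]
  have h3 : IsOpenImmersion (Spec.map (CommRingCat.ofHom (HomogeneousLocalization.Away.map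
      (subst (algebraMap R S) 1) (MvPolynomial.X (R := R) i)))) := h2
  exact MorphismProperty.comp_mem @IsOpenImmersion _ _ (inferInstance) h3

instance isIso_map_id (w : Rˣ) : IsIso (map (RingHom.id R) w) := by
  refine ⟨map (RingHom.id R) w⁻¹, ?_, ?_⟩
  · rw [← map_comp]
    simpa using map_id
  · rw [← map_comp]
    simpa using map_id

lemma isOpenImmersion_map (φ : R →+* S) (w : Sˣ) (f : R)
    (h : letI := φ.toAlgebra; IsLocalization.Away f S) : IsOpenImmersion (map φ w) := by
  let := φ.toAlgebra
  have h1 := isOpenImmersion_map_one (S := S) f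
  have := map_comp φ 1 (RingHom.id S) w
  simp only [map_one, one_mul, RingHom.id_comp] at this
  rw [this]
  change IsOpenImmersion (map (RingHom.id S) w ≫ map (algebraMap R S) 1)
  infer_instance

end ProjLine

/-- Two schemes can be glued along a common open subscheme. -/
instance hasPushout_of_isOpenImmersion {X Y Z : Scheme.{u}} (f : X ⟶ Y) (g : X ⟶ Z)
    [IsOpenImmersion f] [IsOpenImmersion g] : HasPushout f g := by
  have : ∀ {i j} (h : i ⟶ j), IsOpenImmersion ((span f g).map h) := by
    rintro i j (_ | _ | _)
    · simp only [WidePushoutShape.hom_id]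
      infer_instance
    · simpa
    · simpa
  infer_instance

namespace Hirzebruch

variable (R : Type u) [CommRing R] (a : ℕ)

/-- The unit `s ^ a` of the Laurent polynomial ring `R[s, s⁻¹]`. -/
def powUnit : (R[T;T⁻¹])ˣ where
  val := LaurentPolynomial.T a
  inv := LaurentPolynomial.T (-a)
  val_inv := by rw [← LaurentPolynomial.T_add, add_neg_cancel, LaurentPolynomial.T_zero]
  inv_val := by rw [← LaurentPolynomial.T_add, neg_add_cancel, LaurentPolynomial.T_zero]

/-- The inclusion `𝔾ₘ × ℙ¹ → 𝔸¹ × ℙ¹`, `(s, [x₀ : x₁]) ↦ (s, [x₀ : x₁])` (over `R`). -/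
def glueLeft : ProjLine R[T;T⁻¹] ⟶ ProjLine R[X] :=
  ProjLine.map Polynomial.toLaurent 1

/-- The open immersion `𝔾ₘ × ℙ¹ → 𝔸¹ × ℙ¹`, `(s, [x₀ : x₁]) ↦ (s⁻¹, [x₀ : s ^ a x₁])`
(over `R`). -/
def glueRight : ProjLine R[T;T⁻¹] ⟶ ProjLine R[X] :=
  ProjLine.map
    ((LaurentPolynomial.invert (R := R) : R[T;T⁻¹] →+* R[T;T⁻¹]).comp Polynomial.toLaurent)
    (powUnit R a)

instance : IsOpenImmersion (glueLeft R) :=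
  ProjLine.isOpenImmersion_map _ _ Polynomial.X LaurentPolynomial.isLocalization

instance : IsOpenImmersion (glueRight R a) := by
  let e : R[T;T⁻¹] →+* R[T;T⁻¹] := (LaurentPolynomial.invert (R := R) : R[T;T⁻¹] →+* R[T;T⁻¹])
  have he : e.comp e = RingHom.id _ := by
    refine RingHom.ext fun x => ?_
    exact (LaurentPolynomial.invert (R := R)).symm_apply_apply x
  have h1 : ProjLine.map e 1 ≫ ProjLine.map e 1 = 𝟙 _ := by
    rw [← ProjLine.map_comp, he]
    simpa using ProjLine.map_id
  have : IsIso (ProjLine.map e 1) := ⟨ProjLine.map e 1, h1, h1⟩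
  have h2 : glueRight R a =
      ProjLine.map (RingHom.id _) (powUnit R a) ≫ ProjLine.map e 1 ≫ glueLeft R := by
    rw [glueRight, glueLeft, ← ProjLine.map_comp, ← ProjLine.map_comp]
    simp [e]
  rw [h2]
  infer_instance

end Hirzebruch

/-- The Hirzebruch surface `𝔽_a` over a commutative ring `R`: the `ℙ¹`-bundle
`ℙ(𝒪 ⊕ 𝒪(a))` over the projective line, obtained from two copies of `𝔸¹ × ℙ¹` by gluing
`(s, [x₀ : x₁])`, `s ≠ 0`, in the first copy with `(s⁻¹, [x₀ : s ^ a x₁])` in the second. -/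
def Hirzebruch (R : Type u) [CommRing R] (a : ℕ) : Scheme.{u} :=
  pushout (Hirzebruch.glueLeft R) (Hirzebruch.glueRight R a)

/-- The structure morphism `𝔽_a → Spec R`. -/
def Hirzebruch.toSpec (R : Type u) [CommRing R] (a : ℕ) : Hirzebruch R a ⟶ Spec (.of R) :=
  pushout.desc
    (ProjLine.toSpec R[X] ≫ Spec.map (CommRingCat.ofHom Polynomial.C))
    (ProjLine.toSpec R[X] ≫ Spec.map (CommRingCat.ofHom Polynomial.C)) <| by
      rw [glueLeft, glueRight, ← Category.assoc, ← Category.assoc, ProjLine.map_toSpec,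
        ProjLine.map_toSpec, Category.assoc, Category.assoc, ← Spec.map_comp, ← Spec.map_comp,
        ← CommRingCat.ofHom_comp, ← CommRingCat.ofHom_comp]
      congr 3
      ext r : 1
      simp

/-- For a morphism `π : F → 𝔸¹` over `ℂ` and a point `c ∈ K = 𝔸¹(K)` of the affine line with
values in a field extension `K` of `ℂ`, the fibre `F ×_{𝔸¹} Spec K` of `π` over `c` is isomorphic,
as a scheme over `K`, to the Hirzebruch surface `𝔽_a` over `K`. The closed points of `𝔸¹` are the
points with `K = ℂ`. -/
def FibreIsHirzebruch {F : Scheme.{0}} (π : F ⟶ Spec (.of ℂ[X]))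
    {K : Type} [Field K] [Algebra ℂ K] (c : K) (a : ℕ) : Prop :=
  Nonempty
    (Over.mk (pullback.snd π
      (Spec.map (CommRingCat.ofHom (Polynomial.aeval (R := ℂ) c : ℂ[X] →+* K)))) ≅
    Over.mk (Hirzebruch.toSpec K a))

end

/-! Both families are projectivizations of a family of rank-two bundles on `ℙ¹`, parametrized by
`t`. The bundle is the extension of line bundles with transition matrix `[1, 0; t s^n, s^(2n+e)]`,
where `e = 0` or `e = 1`. For `t = 0` the extension splits and the surface is `𝔽_(2n+e)`. For
invertible `t`, invertible changes of trivialization, polynomial in `s` on one chart and in `s⁻¹` on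
the other, turn the matrix into `s^n · diag(1, s^e)`: the degree `2n+e` is redistributed as `n +
(n+e)`. The scalar `s^n` acts trivially on `ℙ¹`, so the surface is `𝔽_e`. This matrix identity is
`Ruled.exists_iso_extGL`.

The rest makes projectivization by a transition matrix precise over any ring. `ProjLine.linMap` is
the action of `GL₂` on `ℙ¹`, and `ProjLine.linMap_scalarGL` says that scalars act trivially. `Ruled
M` is two copies of `𝔸¹ × ℙ¹` glued by `M`. Three facts about it suffice: equivalent matrices give
isomorphic surfaces (`Ruled.isoOfEquiv`); its formation commutes with base change
(`Ruled.isPullback_map`), so a fibre is found by specializing `t`; and it is proper and smooth of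
relative dimension two, being locally a product with `ℙ¹` over `ℙ¹` (`Ruled.toLine`). -/

noncomputable section

/-! ### The action of `GL₂` on the projective line -/

namespace ProjLine

variable {R S T : Type u} [CommRing R] [CommRing S] [CommRing T]

/-- The graded ring homomorphism `R[x₀, x₁] → S[x₀, x₁]` which is `φ` on coefficients and sends
`x_j` to the linear form `∑ k, M j k x_k`. -/
def linSubst (φ : R →+* S) (M : Matrix (Fin 2) (Fin 2) S) : grading R →+*ᵍ grading S where
  toRingHom := MvPolynomial.eval₂Hom (MvPolynomial.C.comp φ)
    fun j => ∑ k, MvPolynomial.C (M j k) * MvPolynomial.X k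
  map_mem {i p} hp := by
    rw [MvPolynomial.mem_homogeneousSubmodule] at hp ⊢
    have := MvPolynomial.IsHomogeneous.eval₂ (n := 1) hp
      (MvPolynomial.C.comp φ : R →+* MvPolynomial (Fin 2) S)
      (fun j => ∑ k, MvPolynomial.C (M j k) * MvPolynomial.X k)
      (fun r => MvPolynomial.isHomogeneous_C _ _)
      (fun j => MvPolynomial.IsHomogeneous.sum _ _ _ fun k _ =>
        (MvPolynomial.isHomogeneous_X _ _).C_mul _)
    simpa using this

@[simp] lemma linSubst_C (φ : R →+* S) (M : Matrix (Fin 2) (Fin 2) S) (r : R) :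
    linSubst φ M (MvPolynomial.C r) = MvPolynomial.C (φ r) := by
  change MvPolynomial.eval₂Hom _ _ _ = _
  simp

@[simp] lemma linSubst_X (φ : R →+* S) (M : Matrix (Fin 2) (Fin 2) S) (j : Fin 2) :
    linSubst φ M (MvPolynomial.X j) = ∑ k, MvPolynomial.C (M j k) * MvPolynomial.X k := by
  change MvPolynomial.eval₂Hom _ _ _ = _
  simp

lemma linSubst_comp (φ : R →+* S) (M : Matrix (Fin 2) (Fin 2) S) (ψ : S →+* T)
    (N : Matrix (Fin 2) (Fin 2) T) :
    (linSubst ψ N).comp (linSubst φ M) = linSubst (ψ.comp φ) (ψ.mapMatrix M * N) := by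
  apply gradedHom_ext
  · simp
  all_goals
    simp only [GradedRingHom.comp_apply, linSubst_X, Fin.sum_univ_two, map_add, map_mul, linSubst_C,
      Matrix.mul_apply, RingHom.mapMatrix_apply, Matrix.map_apply]
    ring

lemma linSubst_diagonal (φ : R →+* S) (w : Sˣ) :
    linSubst φ (Matrix.diagonal ![1, (w : S)]) = subst φ w := by
  apply gradedHom_ext <;> simp [Fin.sum_univ_two]

/-- The inverse matrix recovers each variable as a linear combination of the images of the
variables. This makes the map on `Proj` defined everywhere. -/
lemma irrelevant_le_linSubst (φ : R →+* S) (M : GL (Fin 2) S) :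
    (grading S)₊ ≤ (grading R)₊.map (linSubst φ M.1) := by
  change (HomogeneousIdeal.irrelevant (grading S)).toIdeal ≤ _
  refine (irrelevant_le_span S).trans ?_
  rw [Ideal.span_le]
  have hX (j : Fin 2) : linSubst φ M.1 (MvPolynomial.X j) ∈
      ((grading R)₊.map (linSubst φ M.1)).toIdeal :=
    Ideal.mem_map_of_mem _ (HomogeneousIdeal.mem_irrelevant_of_mem (grading R) one_pos
      (X_mem R j))
  rintro _ ⟨j, rfl⟩
  have h : (MvPolynomial.X j : MvPolynomial (Fin 2) S) =
      ∑ i, MvPolynomial.C (M⁻¹.1 j i) * linSubst φ M.1 (MvPolynomial.X i) := by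
    have hM : M⁻¹.1 * M.1 = 1 := M.inv_mul
    have h' (k : Fin 2) := congr(MvPolynomial.C (σ := Fin 2) ($hM j k))
    simp only [Matrix.mul_apply, Fin.sum_univ_two, map_add, map_mul] at h'
    simp only [linSubst_X, Fin.sum_univ_two]
    have h0 := h' 0
    have h1 := h' 1
    obtain rfl | rfl : j = 0 ∨ j = 1 := by fin_cases j <;> simp
    all_goals
      simp only [Matrix.one_apply, Fin.isValue, zero_ne_one, one_ne_zero, if_true, if_false,
        map_one, map_zero] at h0 h1
      linear_combination (-MvPolynomial.X 0) * h0 - MvPolynomial.X 1 * h1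
  rw [h]
  exact Ideal.sum_mem _ fun i _ => Ideal.mul_mem_left _ _ (hX i)

lemma projMap_congr {f g : grading R →+*ᵍ grading S} (hf : (grading S)₊ ≤ (grading R)₊.map f)
    (hg : (grading S)₊ ≤ (grading R)₊.map g) (h : f = g) : Proj.map f hf = Proj.map g hg := by
  subst h
  rfl

/-- The morphism `ℙ¹_S → ℙ¹_R` over `Spec φ : Spec S → Spec R` which is `x ↦ M x` in homogeneous
coordinates, for `M ∈ GL₂(S)`. -/
def linMap (φ : R →+* S) (M : GL (Fin 2) S) : ProjLine S ⟶ ProjLine R :=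
  Proj.map (linSubst φ M.1) (irrelevant_le_linSubst φ M)

lemma linMap_comp (φ : R →+* S) (M : GL (Fin 2) S) (ψ : S →+* T) (N : GL (Fin 2) T) :
    linMap ψ N ≫ linMap φ M =
      linMap (ψ.comp φ) (Matrix.GeneralLinearGroup.map ψ M * N) := by
  unfold linMap
  rw [← Proj.map_comp _ _ (irrelevant_le_linSubst φ M) (irrelevant_le_linSubst ψ N)]
  exact projMap_congr _ _ (linSubst_comp φ M.1 ψ N.1)

/-- The matrix `diag(1, w)`. -/
def diagGL (w : Sˣ) : GL (Fin 2) S :=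
  Matrix.GeneralLinearGroup.mk'' (Matrix.diagonal ![1, (w : S)]) (by simp)

lemma linMap_diagGL (φ : R →+* S) (w : Sˣ) : linMap φ (diagGL w) = map φ w := by
  exact projMap_congr _ _ (linSubst_diagonal φ w)

lemma diagGL_one : diagGL (1 : Sˣ) = 1 := by
  refine Units.ext ?_
  change Matrix.diagonal ![1, ((1 : Sˣ) : S)] = 1
  ext i j
  fin_cases i <;> fin_cases j <;> simp

lemma linMap_one (φ : R →+* S) : linMap φ 1 = map φ 1 := by
  rw [← diagGL_one, linMap_diagGL]

lemma linMap_id : linMap (RingHom.id R) 1 = 𝟙 (ProjLine R) := by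
  rw [linMap_one, map_id]

/-- The first factor is an automorphism, so geometric properties of `linMap φ M` reduce to those of
the base-change map `map φ 1`. -/
lemma linMap_eq_comp (φ : R →+* S) (M : GL (Fin 2) S) :
    linMap φ M = linMap (RingHom.id S) M ≫ map φ 1 := by
  rw [← linMap_one, linMap_comp]
  simp

instance isIso_linMap_id (M : GL (Fin 2) R) : IsIso (linMap (RingHom.id R) M) := by
  refine ⟨linMap (RingHom.id R) M⁻¹, ?_, ?_⟩
  · rw [linMap_comp]
    simpa using linMap_id
  · rw [linMap_comp]
    simpa using linMap_id

lemma isOpenImmersion_linMap (φ : R →+* S) (M : GL (Fin 2) S) (f : R)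
    (h : letI := φ.toAlgebra; IsLocalization.Away f S) : IsOpenImmersion (linMap φ M) := by
  have := isOpenImmersion_map φ 1 f h
  rw [linMap_eq_comp]
  infer_instance

lemma away_map_linSubst_comp_algebraMap (φ : R →+* S) (M : Matrix (Fin 2) (Fin 2) S)
    (p : MvPolynomial (Fin 2) R) :
    ((HomogeneousLocalization.Away.map (linSubst φ M) p).comp
      (HomogeneousLocalization.fromZeroRingHom (grading R) (Submonoid.powers p))).comp
        (algebraMap R (grading R 0)) =
    ((HomogeneousLocalization.fromZeroRingHom (grading S)
      (Submonoid.powers (linSubst φ M p))).comp (algebraMap S (grading S 0))).comp φ := by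
  ext r
  simp only [RingHom.comp_apply]
  change HomogeneousLocalization.val (HomogeneousLocalization.map _ _
    (HomogeneousLocalization.mk _)) = HomogeneousLocalization.val (HomogeneousLocalization.mk _)
  rw [HomogeneousLocalization.map_mk, HomogeneousLocalization.val_mk,
    HomogeneousLocalization.val_mk]
  congr 1
  · exact linSubst_C φ M r
  · exact Subtype.ext (map_one (linSubst φ M))

lemma awayι_linMap_toSpec (φ : R →+* S) (M : GL (Fin 2) S) {k : ℕ} (hk : 0 < k)
    (p : MvPolynomial (Fin 2) R) (hp : p ∈ grading R k) :
    Proj.awayι (grading S) (linSubst φ M.1 p) (Graded.map_mem (linSubst φ M.1) hp) hk ≫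
        linMap φ M ≫ toSpec R =
      Proj.awayι (grading S) (linSubst φ M.1 p) (Graded.map_mem (linSubst φ M.1) hp) hk ≫
        toSpec S ≫ Spec.map (CommRingCat.ofHom φ) := by
  rw [linMap, toSpec, toSpec, Category.assoc, Proj.awayι_comp_map_assoc _ _ hk _ hp,
    Proj.awayι_toSpecZero_assoc, Proj.awayι_toSpecZero_assoc, ← Spec.map_comp, ← Spec.map_comp,
    ← Spec.map_comp, ← Spec.map_comp]
  exact congrArg (fun g => Spec.map (CommRingCat.ofHom g))
    (away_map_linSubst_comp_algebraMap φ M.1 p)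

lemma linMap_toSpec (φ : R →+* S) (M : GL (Fin 2) S) :
    linMap φ M ≫ toSpec R = toSpec S ≫ Spec.map (CommRingCat.ofHom φ) :=
  (Proj.mapAffineOpenCover _ (irrelevant_le_linSubst φ M)).openCover.hom_ext _ _ fun s =>
    awayι_linMap_toSpec φ M s.1.2 _ s.2.2

/-! ### Scalar matrices act trivially -/

/-- The scalar matrix of a unit. -/
def scalarGL (w : Sˣ) : GL (Fin 2) S := Units.map (Matrix.scalar (Fin 2)).toMonoidHom w

lemma eval₂_mul_of_mem_grading (φ : R →+* S) (c : S) (y : Fin 2 → S) {n : ℕ}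
    {p : MvPolynomial (Fin 2) R} (hp : p ∈ grading R n) :
    MvPolynomial.eval₂ φ (fun j => c * y j) p = c ^ n * MvPolynomial.eval₂ φ y p := by
  rw [MvPolynomial.eval₂_eq', MvPolynomial.eval₂_eq', Finset.mul_sum]
  refine Finset.sum_congr rfl fun d hd => ?_
  have h : d 0 + d 1 = n := by
    have := hp (MvPolynomial.mem_support_iff.mp hd)
    simpa [Finsupp.weight_apply, Finsupp.sum_fintype] using this
  simp only [Fin.prod_univ_two, ← h]
  ring

lemma linSubst_scalar (w : R) {n : ℕ} {p : MvPolynomial (Fin 2) R} (hp : p ∈ grading R n) :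
    linSubst (RingHom.id R) (Matrix.scalar (Fin 2) w) p = MvPolynomial.C (w ^ n) * p := by
  have h : (linSubst (RingHom.id R) (Matrix.scalar (Fin 2) w)).toRingHom =
      MvPolynomial.eval₂Hom MvPolynomial.C fun j => MvPolynomial.C w * MvPolynomial.X j := by
    refine MvPolynomial.ringHom_ext (fun r => ?_) fun j => ?_
    · exact (linSubst_C _ _ r).trans (by simp)
    · exact (linSubst_X _ _ j).trans (by fin_cases j <;> simp [Fin.sum_univ_two])
  refine (DFunLike.congr_fun h p).trans ?_
  rw [MvPolynomial.coe_eval₂Hom, eval₂_mul_of_mem_grading _ _ _ hp, MvPolynomial.eval₂_eta, map_pow]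

/-- In a degree-zero fraction `a / p^m` the numerator and the denominator are both multiplied by
`w^(km)`, so the fraction does not change. -/
lemma awayι_linMap_scalarGL (w : Rˣ) {k : ℕ} (hk : 0 < k)
    (p : MvPolynomial (Fin 2) R) (hp : p ∈ grading R k) :
    Proj.awayι (grading R) (linSubst (RingHom.id R) (scalarGL w).1 p)
        (Graded.map_mem (linSubst (RingHom.id R) (scalarGL w).1) hp) hk ≫
      linMap (RingHom.id R) (scalarGL w) =
    Proj.awayι (grading R) (linSubst (RingHom.id R) (scalarGL w).1 p)
      (Graded.map_mem (linSubst (RingHom.id R) (scalarGL w).1) hp) hk ≫ 𝟙 _ := by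
  rw [linMap, Proj.awayι_comp_map _ _ hk _ hp, Category.comp_id]
  have hx : linSubst (RingHom.id R) (scalarGL w).1 p = p * MvPolynomial.C ((w : R) ^ k) := by
    rw [mul_comm]; exact linSubst_scalar _ hp
  -- The two sides use the charts of `p` and of `w^k p`; the localization map between them puts both
  -- over the chart of `p`.
  rw [← Proj.SpecMap_awayMap_awayι (grading R) hp hk (C_mem ((w : R) ^ k)) hx]
  congr 3
  ext z
  obtain ⟨m, a, ha, rfl⟩ := HomogeneousLocalization.Away.mk_surjective (grading R) hp z
  rw [HomogeneousLocalization.Away.map_mk]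
  simp only [HomogeneousLocalization.Away.mk, HomogeneousLocalization.val_awayMap_mk,
    HomogeneousLocalization.val_mk]
  congr 1
  change linSubst (RingHom.id R) (Matrix.scalar (Fin 2) (w : R)) a = _
  rw [linSubst_scalar _ ha, mul_comm]
  simp [pow_mul, mul_comm]

lemma linMap_scalarGL (w : Rˣ) : linMap (RingHom.id R) (scalarGL w) = 𝟙 (ProjLine R) :=
  (Proj.mapAffineOpenCover _ (irrelevant_le_linSubst (RingHom.id R) (scalarGL w))).openCover.hom_ext
    _ _ fun s => awayι_linMap_scalarGL w s.1.2 _ s.2.2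

end ProjLine

/-! ### Gluing along an open subscheme, and cartesian squares checked locally -/

namespace AlgebraicGeometry

section Pushout

variable {U X Y : Scheme.{u}} (f : U ⟶ X) (g : U ⟶ Y) [IsOpenImmersion f] [IsOpenImmersion g]

instance isOpenImmersion_span_map {i j : WalkingSpan} (h : i ⟶ j) :
    IsOpenImmersion ((span f g).map h) := by
  obtain _ | _ | _ := h
  · simp only [WidePushoutShape.hom_id]
    infer_instance
  · simpa
  · simpa

instance isOpenImmersion_pushout_inl : IsOpenImmersion (pushout.inl f g) :=
  inferInstanceAs (IsOpenImmersion (colimit.ι (span f g) WalkingSpan.left))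

instance isOpenImmersion_pushout_inr : IsOpenImmersion (pushout.inr f g) :=
  inferInstanceAs (IsOpenImmersion (colimit.ι (span f g) WalkingSpan.right))

lemma pushout_jointly_surjective (z : ↥(pushout f g)) :
    (∃ x, pushout.inl f g x = z) ∨ ∃ y, pushout.inr f g y = z := by
  obtain ⟨_ | _ | _, x, hx⟩ := Scheme.IsLocallyDirected.ι_jointly_surjective (span f g) z
  · left
    refine ⟨f x, ?_⟩
    rw [← hx, ← colimit.w (span f g) WalkingSpan.Hom.fst]
    rfl
  · exact .inl ⟨x, hx⟩
  · exact .inr ⟨x, hx⟩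

lemma exists_of_pushout_inl_eq_inr {x : X} {y : Y} (h : pushout.inl f g x = pushout.inr f g y) :
    ∃ u, f u = x ∧ g u = y := by
  obtain ⟨k, fi, fj, z, hi, hj⟩ := (Scheme.IsLocallyDirected.ι_eq_ι_iff (span f g)
    (i := WalkingSpan.left) (j := WalkingSpan.right)).mp h
  -- Only the apex of the span maps to both feet; either other case would need a morphism from one
  -- foot to the other.
  obtain _ | _ | _ := k
  · obtain rfl : fi = WalkingSpan.Hom.fst := Subsingleton.elim _ _
    obtain rfl : fj = WalkingSpan.Hom.snd := Subsingleton.elim _ _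
    exact ⟨z, hi, hj⟩
  · exact nomatch (show WidePushoutShape.Hom _ _ from fj)
  · exact nomatch (show WidePushoutShape.Hom _ _ from fi)

variable {f g} {B V : Scheme.{u}}

/-- A criterion for a chart of a glued scheme to be the preimage of an open subscheme. -/
lemma isPullback_pushout_inl (h : pushout f g ⟶ B) (q : X ⟶ V) (p : V ⟶ B) [IsOpenImmersion p]
    (w : pushout.inl f g ≫ h = q ≫ p)
    (H : ∀ y : Y, (pushout.inr f g ≫ h) y ∈ Set.range p → y ∈ Set.range g) :
    IsPullback q (pushout.inl f g) p h := by
  refine IsOpenImmersion.isPullback _ _ _ _ w ?_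
  ext z
  constructor
  · intro hz
    obtain ⟨x, rfl⟩ | ⟨y, rfl⟩ := pushout_jointly_surjective f g z
    · exact ⟨x, rfl⟩
    -- By `H`, a point of the other chart lying over `V` is in the overlap, hence already in this
    -- chart.
    · obtain ⟨u, rfl⟩ := H y hz
      refine ⟨f u, ?_⟩
      rw [← Scheme.Hom.comp_apply, ← Scheme.Hom.comp_apply, pushout.condition]
  · rintro ⟨x, rfl⟩
    refine ⟨q x, ?_⟩
    rw [← Scheme.Hom.comp_apply, ← Scheme.Hom.comp_apply, w]

lemma isPullback_pushout_inr (h : pushout f g ⟶ B) (q : Y ⟶ V) (p : V ⟶ B) [IsOpenImmersion p]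
    (w : pushout.inr f g ≫ h = q ≫ p)
    (H : ∀ x : X, (pushout.inl f g ≫ h) x ∈ Set.range p → x ∈ Set.range f) :
    IsPullback q (pushout.inr f g) p h := by
  refine IsOpenImmersion.isPullback _ _ _ _ w ?_
  ext z
  constructor
  · intro hz
    obtain ⟨x, rfl⟩ | ⟨y, rfl⟩ := pushout_jointly_surjective f g z
    · obtain ⟨u, rfl⟩ := H x hz
      refine ⟨g u, ?_⟩
      rw [← Scheme.Hom.comp_apply, ← Scheme.Hom.comp_apply, pushout.condition]
    · exact ⟨y, rfl⟩
  · rintro ⟨x, rfl⟩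
    refine ⟨q x, ?_⟩
    rw [← Scheme.Hom.comp_apply, ← Scheme.Hom.comp_apply, w]

end Pushout

/-- The open cover of a scheme by two open subschemes. -/
def pairCover {X Y Z : Scheme.{u}} (i : X ⟶ Z) (j : Y ⟶ Z) [IsOpenImmersion i] [IsOpenImmersion j]
    (h : ∀ z, (∃ x, i x = z) ∨ ∃ y, j y = z) : Z.OpenCover where
  I₀ := ULift.{u} Bool
  X b := cond b.down X Y
  f b := match b with
    | ⟨true⟩ => i
    | ⟨false⟩ => j
  mem₀ := by
    rw [Scheme.presieve₀_mem_precoverage_iff]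
    refine ⟨fun z => ?_, ?_⟩
    · obtain ⟨x, hx⟩ | ⟨y, hy⟩ := h z
      · exact ⟨⟨true⟩, x, hx⟩
      · exact ⟨⟨false⟩, y, hy⟩
    · rintro ⟨_ | _⟩
      · exact ‹IsOpenImmersion j›
      · exact ‹IsOpenImmersion i›

/-- Being cartesian can be checked on an open cover. -/
lemma isPullback_of_openCover {X' X S' S : Scheme.{u}} {a : X' ⟶ X} {b' : X' ⟶ S'} {b : X ⟶ S}
    {c : S' ⟶ S} (w : a ≫ b = b' ≫ c) (𝒰 : X.OpenCover) (V : 𝒰.I₀ → Scheme.{u})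
    (j : ∀ i, V i ⟶ X') (q : ∀ i, V i ⟶ 𝒰.X i)
    (h₁ : ∀ i, IsPullback (q i) (j i) (𝒰.f i) a)
    (h₂ : ∀ i, IsPullback (q i) (j i ≫ b') (𝒰.f i ≫ b) c) : IsPullback a b' b c := by
  let ℓ : X' ⟶ pullback b c := pullback.lift a b' w
  suffices IsIso ℓ from
    IsPullback.of_iso_pullback ⟨w⟩ (asIso ℓ) (pullback.lift_fst _ _ _)
      (pullback.lift_snd _ _ _)
  let 𝒱 := 𝒰.pullback₁ (pullback.fst b c)
  -- The comparison map `ℓ` to the fibre product is an isomorphism if it is one over each member of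
  -- the cover pulled back from `X`. There it becomes `e`, the isomorphism supplied by `h₂`.
  refine (IsZariskiLocalAtTarget.of_openCover (P := MorphismProperty.isomorphisms Scheme) 𝒱 fun i => ?_)
  change IsIso (pullback.snd ℓ (pullback.fst (pullback.fst b c) (𝒰.f i)))
  have hQ : IsPullback (pullback.snd (pullback.fst b c) (𝒰.f i))
      (pullback.fst (pullback.fst b c) (𝒰.f i)) (𝒰.f i) (pullback.fst b c) :=
    (IsPullback.of_hasPullback _ _).flip
  have hQ' := hQ.flip.paste_horiz (IsPullback.of_hasPullback b c).flip
  let e := (h₂ i).flip.isoIsPullback _ _ hQ'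
  have he : e.hom ≫ pullback.snd _ _ = q i := IsPullback.isoIsPullback_hom_snd ..
  have he' : e.hom ≫ pullback.fst _ _ ≫ pullback.snd _ _ = j i ≫ b' :=
    IsPullback.isoIsPullback_hom_fst ..
  have hℓ : ℓ ≫ pullback.fst _ _ = a := pullback.lift_fst _ _ _
  have hℓ' : ℓ ≫ pullback.snd _ _ = b' := pullback.lift_snd _ _ _
  have key : IsPullback (j i) e.hom ℓ (pullback.fst (pullback.fst b c) (𝒰.f i)) := by
    refine IsPullback.of_bot (v₂₁ := pullback.snd _ _) (v₂₂ := pullback.fst _ _) (h₃₁ := 𝒰.f i)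
      ?_ ?_ hQ.flip
    · rw [he, hℓ]
      exact (h₁ i).flip
    · refine pullback.hom_ext ?_ ?_
      · rw [Category.assoc, Category.assoc, hℓ, pullback.condition, reassoc_of% he, (h₁ i).w]
      · rw [Category.assoc, Category.assoc, hℓ', he']
  rw [← key.isoPullback_inv_snd]
  infer_instance

end AlgebraicGeometry

/-! ### Points of the projective line in homogeneous coordinates -/

namespace ProjLine

variable {R S T : Type u} [CommRing R] [CommRing S] [CommRing T]

lemma awayLift_mk_mul_pow (f : R →+* S) {p : R} (hp : IsUnit (f p)) (a : R) (n : ℕ) :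
    Localization.awayLift f p hp (Localization.mk a ⟨p ^ n, n, rfl⟩) * f p ^ n = f a := by
  obtain ⟨v, hv⟩ := hp.exists_right_inv
  rw [Localization.awayLift_mk f p a v hv, mul_assoc, ← mul_pow, mul_comm v, hv, one_pow, mul_one]

/-- Evaluation of homogeneous fractions `a / p ^ n` at a point `y` where `p` is invertible. -/
def awayEval (φ : R →+* S) (y : Fin 2 → S) (p : MvPolynomial (Fin 2) R)
    (hp : IsUnit (MvPolynomial.eval₂ φ y p)) :
    HomogeneousLocalization.Away (grading R) p →+* S :=
  (Localization.awayLift (MvPolynomial.eval₂Hom φ y) p hp).comp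
    (algebraMap (HomogeneousLocalization.Away (grading R) p) (Localization.Away p))

/-- With the denominator cleared no inverse in `S` has to be named. Since the value of `p` is a
unit, this equation characterizes `awayEval`, which is how `away_hom_ext` uses it. -/
lemma awayEval_mk (φ : R →+* S) (y : Fin 2 → S) {p : MvPolynomial (Fin 2) R}
    (hp : IsUnit (MvPolynomial.eval₂ φ y p)) {d : ℕ} (hd : p ∈ grading R d) (n : ℕ)
    (a : MvPolynomial (Fin 2) R) (ha : a ∈ grading R (n • d)) :
    awayEval φ y p hp (HomogeneousLocalization.Away.mk (grading R) hd n a ha) *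
      MvPolynomial.eval₂ φ y p ^ n = MvPolynomial.eval₂ φ y a := by
  have h : awayEval φ y p hp (HomogeneousLocalization.Away.mk (grading R) hd n a ha) =
      Localization.awayLift (MvPolynomial.eval₂Hom φ y) p hp
        (HomogeneousLocalization.Away.mk (grading R) hd n a ha).val := rfl
  rw [h, HomogeneousLocalization.Away.val_mk]
  exact awayLift_mk_mul_pow _ hp a n

lemma away_hom_ext {p : MvPolynomial (Fin 2) R} {d : ℕ} (hd : p ∈ grading R d)
    {f : HomogeneousLocalization.Away (grading R) p →+* S} {φ : R →+* S} {y : Fin 2 → S}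
    (hp : IsUnit (MvPolynomial.eval₂ φ y p))
    (h : ∀ n a ha, f (HomogeneousLocalization.Away.mk (grading R) hd n a ha) *
      MvPolynomial.eval₂ φ y p ^ n = MvPolynomial.eval₂ φ y a) : f = awayEval φ y p hp := by
  ext z
  obtain ⟨n, a, ha, rfl⟩ := HomogeneousLocalization.Away.mk_surjective (grading R) hd z
  exact (hp.pow n).mul_right_cancel ((h n a ha).trans (awayEval_mk φ y hp hd n a ha).symm)

/-- The `S`-valued point `[y₀ : y₁]` of `ℙ¹`, which lies in the open set where `p` is invertible. -/
def point (φ : R →+* S) (y : Fin 2 → S) {d : ℕ} (hd : 0 < d) (p : MvPolynomial (Fin 2) R)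
    (hpd : p ∈ grading R d) (hp : IsUnit (MvPolynomial.eval₂ φ y p)) :
    Spec (.of S) ⟶ ProjLine R :=
  Spec.map (CommRingCat.ofHom (awayEval φ y p hp)) ≫ Proj.awayι (grading R) p hpd hd

lemma point_congr {φ φ' : R →+* S} {y y' : Fin 2 → S} {d : ℕ} (hd : 0 < d)
    {p p' : MvPolynomial (Fin 2) R} (hpd : p ∈ grading R d)
    (hp : IsUnit (MvPolynomial.eval₂ φ y p)) (hφ : φ = φ') (hy : y = y') (hpp : p = p') :
    point φ y hd p hpd hp = point φ' y' hd p' (hpp ▸ hpd) (by rwa [← hφ, ← hy, ← hpp]) := by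
  subst hφ hy hpp
  rfl

lemma point_eq_point_mul (φ : R →+* S) (y : Fin 2 → S) {d e : ℕ} (hd : 0 < d)
    {p q : MvPolynomial (Fin 2) R} (hpd : p ∈ grading R d) (hqe : q ∈ grading R e)
    (hp : IsUnit (MvPolynomial.eval₂ φ y p)) {x : MvPolynomial (Fin 2) R} (hx : x = p * q)
    (hxe : IsUnit (MvPolynomial.eval₂ φ y x)) {k : ℕ} (hk : 0 < k) (hkde : k = d + e)
    (hxk : x ∈ grading R k) :
    point φ y hd p hpd hp = point φ y hk x hxk hxe := by
  subst hkde
  rw [point, point, ← Proj.SpecMap_awayMap_awayι (grading R) hpd hd hqe hx, ← Spec.map_comp_assoc,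
    ← CommRingCat.ofHom_comp]
  congr 3
  refine (away_hom_ext hpd hp fun n a ha => ?_).symm
  have hx' : MvPolynomial.eval₂ φ y x = MvPolynomial.eval₂ φ y p * MvPolynomial.eval₂ φ y q := by
    rw [hx, MvPolynomial.eval₂_mul]
  have hq : IsUnit (MvPolynomial.eval₂ φ y q) := isUnit_of_mul_isUnit_right (hx' ▸ hxe)
  have hm : a * q ^ n ∈ grading R (n • (d + e)) := by
    rw [smul_add]
    exact SetLike.mul_mem_graded ha (SetLike.pow_mem_graded n hqe)
  have h1 : HomogeneousLocalization.awayMap (grading R) hqe hx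
      (HomogeneousLocalization.Away.mk (grading R) hpd n a ha) =
    HomogeneousLocalization.Away.mk (grading R) (hx ▸ SetLike.mul_mem_graded hpd hqe) n
      (a * q ^ n) hm := by
    ext
    simp only [HomogeneousLocalization.Away.mk, HomogeneousLocalization.val_awayMap_mk,
      HomogeneousLocalization.val_mk]
  refine (hq.pow n).mul_right_cancel ?_
  rw [RingHom.comp_apply, h1, mul_assoc, ← mul_pow, ← hx', awayEval_mk, MvPolynomial.eval₂_mul,
    MvPolynomial.eval₂_pow]

/-- The point does not depend on the chart used to define it: both sides agree with the description
in the chart of `p * q`. -/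
lemma point_eq_point (φ : R →+* S) (y : Fin 2 → S) {d e : ℕ} (hd : 0 < d) (he : 0 < e)
    {p q : MvPolynomial (Fin 2) R} (hpd : p ∈ grading R d) (hqe : q ∈ grading R e)
    (hp : IsUnit (MvPolynomial.eval₂ φ y p)) (hq : IsUnit (MvPolynomial.eval₂ φ y q)) :
    point φ y hd p hpd hp = point φ y he q hqe hq := by
  have h : IsUnit (MvPolynomial.eval₂ φ y (p * q)) := by
    rw [MvPolynomial.eval₂_mul]; exact hp.mul hq
  have hpq := SetLike.mul_mem_graded hpd hqe
  rw [point_eq_point_mul φ y hd hpd hqe hp rfl h (by lia) rfl hpq,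
    point_eq_point_mul φ y he hqe hpd hq (mul_comm p q) h (by lia) (add_comm d e) hpq]

/-- Numerator and denominator both scale by `c^(dn)`. This factor cancels because `c^d` divides the
value of `p` at `c y`, which is a unit. -/
lemma point_smul (φ : R →+* S) (y : Fin 2 → S) (c : S) {d : ℕ} (hd : 0 < d)
    {p : MvPolynomial (Fin 2) R} (hpd : p ∈ grading R d)
    (hp : IsUnit (MvPolynomial.eval₂ φ y p))
    (hp' : IsUnit (MvPolynomial.eval₂ φ (fun j => c * y j) p)) :
    point φ (fun j => c * y j) hd p hpd hp' = point φ y hd p hpd hp := by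
  rw [point, point]
  congr 3
  refine away_hom_ext hpd hp fun n a ha => ?_
  have h := awayEval_mk φ (fun j => c * y j) hp' hpd n a ha
  rw [eval₂_mul_of_mem_grading _ _ _ hpd] at hp'
  rw [eval₂_mul_of_mem_grading _ _ _ hpd, eval₂_mul_of_mem_grading _ _ _ ha, mul_pow, ← pow_mul,
    mul_left_comm, smul_eq_mul, mul_comm n d] at h
  refine ((isUnit_of_mul_isUnit_left hp').pow n).mul_left_cancel ?_
  rwa [← pow_mul]

lemma specMap_point (ψ : S →+* T) (φ : R →+* S) (y : Fin 2 → S) {d : ℕ} (hd : 0 < d)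
    {p : MvPolynomial (Fin 2) R} (hpd : p ∈ grading R d)
    (hp : IsUnit (MvPolynomial.eval₂ φ y p)) :
    Spec.map (CommRingCat.ofHom ψ) ≫ point φ y hd p hpd hp =
      point (ψ.comp φ) (ψ ∘ y) hd p hpd (by
        have := hp.map ψ
        rwa [MvPolynomial.hom_eval₂] at this) := by
  rw [point, point, ← Spec.map_comp_assoc, ← CommRingCat.ofHom_comp]
  congr 3
  refine away_hom_ext hpd _ fun n a ha => ?_
  change _ * MvPolynomial.eval₂ _ (fun i => ψ (y i)) _ ^ n =
    MvPolynomial.eval₂ _ (fun i => ψ (y i)) _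
  rw [← MvPolynomial.hom_eval₂, ← MvPolynomial.hom_eval₂, ← map_pow, RingHom.comp_apply, ← map_mul,
    awayEval_mk]

lemma eval₂_linSubst (ψ : R →+* S) (M : Matrix (Fin 2) (Fin 2) S) (φ : S →+* T) (y : Fin 2 → T)
    (p : MvPolynomial (Fin 2) R) :
    MvPolynomial.eval₂ φ y (linSubst ψ M p) =
      MvPolynomial.eval₂ (φ.comp ψ) ((M.map φ).mulVec y) p := by
  have : (MvPolynomial.eval₂Hom φ y).comp (linSubst ψ M).toRingHom =
      MvPolynomial.eval₂Hom (φ.comp ψ) ((M.map φ).mulVec y) := by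
    refine MvPolynomial.ringHom_ext (fun r => ?_) fun j => ?_
    · refine (congrArg (MvPolynomial.eval₂Hom φ y) (linSubst_C ψ M r)).trans ?_
      simp
    · refine (congrArg (MvPolynomial.eval₂Hom φ y) (linSubst_X ψ M j)).trans ?_
      fin_cases j <;> simp
  exact DFunLike.congr_fun this p

lemma point_linMap (ψ : R →+* S) (M : GL (Fin 2) S) (φ : S →+* T) (y : Fin 2 → T) {d : ℕ}
    (hd : 0 < d) {p : MvPolynomial (Fin 2) R} (hpd : p ∈ grading R d)
    (hp : IsUnit (MvPolynomial.eval₂ φ y (linSubst ψ M.1 p))) :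
    point φ y hd (linSubst ψ M.1 p) (Graded.map_mem (linSubst ψ M.1) hpd) hp ≫ linMap ψ M =
      point (φ.comp ψ) ((M.1.map φ).mulVec y) hd p hpd (by rwa [← eval₂_linSubst]) := by
  rw [point, point, Category.assoc, linMap, Proj.awayι_comp_map _ _ hd _ hpd,
    ← Spec.map_comp_assoc, ← CommRingCat.ofHom_comp]
  congr 3
  refine away_hom_ext hpd _ fun n a ha => ?_
  rw [RingHom.comp_apply, HomogeneousLocalization.Away.map_mk, ← eval₂_linSubst, ← eval₂_linSubst]
  exact awayEval_mk ..

lemma awayEval_comp_algebraMap (φ : R →+* S) (y : Fin 2 → S) {p : MvPolynomial (Fin 2) R}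
    (hp : IsUnit (MvPolynomial.eval₂ φ y p)) {d : ℕ} (hpd : p ∈ grading R d) :
    (awayEval φ y p hp).comp ((HomogeneousLocalization.fromZeroRingHom (grading R)
      (Submonoid.powers p)).comp (algebraMap R (grading R 0))) = φ := by
  ext r
  have := awayEval_mk φ y hp hpd 0 (MvPolynomial.C r) (by rw [zero_smul]; exact C_mem r)
  rw [pow_zero, mul_one, MvPolynomial.eval₂_C] at this
  rw [← this]
  simp only [RingHom.comp_apply]
  congr 1
  ext
  rw [HomogeneousLocalization.Away.val_mk]
  change HomogeneousLocalization.val (HomogeneousLocalization.mk _) = _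
  rw [HomogeneousLocalization.val_mk]
  congr 1

lemma point_toSpec (φ : R →+* S) (y : Fin 2 → S) {d : ℕ} (hd : 0 < d)
    {p : MvPolynomial (Fin 2) R} (hpd : p ∈ grading R d)
    (hp : IsUnit (MvPolynomial.eval₂ φ y p)) :
    point φ y hd p hpd hp ≫ toSpec R = Spec.map (CommRingCat.ofHom φ) := by
  rw [point, toSpec, Category.assoc, Proj.awayι_toSpecZero_assoc, ← Spec.map_comp,
    ← Spec.map_comp, ← CommRingCat.ofHom_comp, ← CommRingCat.ofHom_comp,
    awayEval_comp_algebraMap φ y hp hpd]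

end ProjLine

/-- The presentation of a polynomial ring without relations. -/
def MvPolynomial.submersivePresentation (R ι : Type*) [CommRing R] :
    Algebra.SubmersivePresentation R (MvPolynomial ι R) ι PEmpty where
  toGenerators := .ofSurjective MvPolynomial.X fun p => ⟨p, by simp⟩
  relation := PEmpty.elim
  span_range_relation_eq_ker := by
    rw [Algebra.Generators.ker_eq_ker_aeval_val, Set.range_eq_empty, Ideal.span_empty, eq_comm,
      RingHom.ker_eq_bot_iff_eq_zero]
    intro p hp
    simpa [Algebra.Generators.ofSurjective] using hp
  map := PEmpty.elim
  map_inj := fun x => x.elim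
  jacobian_isUnit := by
    rw [Algebra.PreSubmersivePresentation.jacobian_eq_jacobiMatrix_det]
    simp

/-- One generator and no relations give dimension one, and the Jacobian is the determinant of an
empty matrix. -/
instance Polynomial.isStandardSmoothOfRelativeDimension_one (R : Type*) [CommRing R] :
    Algebra.IsStandardSmoothOfRelativeDimension 1 R R[X] :=
  have : Algebra.IsStandardSmoothOfRelativeDimension 1 R (MvPolynomial PUnit.{1} R) :=
    (MvPolynomial.submersivePresentation.{_, _, 0} R PUnit).isStandardSmoothOfRelativeDimension
      (by simp [Algebra.Presentation.dimension])
  .of_algEquiv 1 (MvPolynomial.uniqueAlgEquiv R PUnit)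

/-! ### Standard charts, base change, smoothness and properness of `ℙ¹` -/

namespace ProjLine

variable {R S : Type u} [CommRing R] [CommRing S]

/-- The homogeneous coordinates of the universal point of the `i`-th standard chart of `ℙ¹`. -/
def coord (R : Type u) [CommRing R] (i j : Fin 2) : R[X] := if j = i then 1 else Polynomial.X

/-- The `i`-th standard chart `𝔸¹ → ℙ¹`. -/
def chart (R : Type u) [CommRing R] (i : Fin 2) : Spec (.of R[X]) ⟶ ProjLine R :=
  point Polynomial.C (coord R i) one_pos (MvPolynomial.X i) (X_mem R i) (by simp [coord])

/-- The inverse `ψ` sends the variable to `x_(1-i) / x_i`, where `1 - i` is the other index in `Fin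
2`. -/
lemma awayEval_coord_bijective (i : Fin 2)
    (hi : IsUnit (MvPolynomial.eval₂ Polynomial.C (coord R i) (MvPolynomial.X i))) :
    Function.Bijective (awayEval Polynomial.C (coord R i) (MvPolynomial.X i) hi) := by
  let A := HomogeneousLocalization.Away (grading R) (MvPolynomial.X (R := R) i)
  let ι : R →+* A := (HomogeneousLocalization.fromZeroRingHom (grading R) _).comp
    (algebraMap R (grading R 0))
  let x (j : Fin 2) : A := HomogeneousLocalization.Away.mk (grading R) (X_mem R i) 1
    (MvPolynomial.X j) (X_mem R j)
  let ψ : R[X] →+* A := Polynomial.eval₂RingHom ι (x (1 - i))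
  have hψC : ψ.comp Polynomial.C = ι := by ext; simp [ψ]
  have hψX : ψ Polynomial.X = x (1 - i) := by simp [ψ]
  have hxi : x i = 1 := by
    ext
    rw [HomogeneousLocalization.Away.val_mk, HomogeneousLocalization.val_one, Localization.mk_eq_mk',
      IsLocalization.mk'_eq_iff_eq_mul]
    simp
  have hx : ψ ∘ coord R i = x := by
    ext1 j
    by_cases h : j = i
    · subst h
      simp [coord, hxi]
    · have : j = 1 - i := by lia
      rw [Function.comp_apply, coord, if_neg h, hψX, this]
  have hev (j : Fin 2) : awayEval Polynomial.C (coord R i) (MvPolynomial.X i) hi (x j) =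
      coord R i j := by
    have := awayEval_mk Polynomial.C (coord R i) hi (X_mem R i) 1 _ (X_mem R j)
    simpa [coord] using this
  constructor
  · refine Function.LeftInverse.injective (g := ψ) fun z => ?_
    obtain ⟨n, a, ha, rfl⟩ := HomogeneousLocalization.Away.mk_surjective (grading R) (X_mem R i) z
    have h := awayEval_mk Polynomial.C (coord R i) hi (X_mem R i) n _ ha
    have h1 : MvPolynomial.eval₂ Polynomial.C (coord R i) (MvPolynomial.X i) = 1 := by simp [coord]
    rw [h1, one_pow, mul_one] at h
    rw [h, MvPolynomial.hom_eval₂, hψC]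
    change MvPolynomial.eval₂ ι (ψ ∘ coord R i) a = _
    rw [hx]
    let L := Localization.Away (MvPolynomial.X (R := R) i)
    let c : L := Localization.mk 1 ⟨MvPolynomial.X i, 1, pow_one _⟩
    have hval (j : Fin 2) : algebraMap A L (x j) = c * algebraMap (MvPolynomial (Fin 2) R) L (MvPolynomial.X j) := by
      change (HomogeneousLocalization.Away.mk (grading R) (X_mem R i) 1 (MvPolynomial.X j)
        (X_mem R j)).val = _
      rw [HomogeneousLocalization.Away.val_mk, ← Localization.mk_one_eq_algebraMap,
        Localization.mk_mul]
      simp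
    have hι : (algebraMap A L).comp ι = (algebraMap (MvPolynomial (Fin 2) R) L).comp MvPolynomial.C := by
      ext r
      change HomogeneousLocalization.val (HomogeneousLocalization.mk
        (⟨0, algebraMap R (grading R 0) r, 1, _⟩ : HomogeneousLocalization.NumDenSameDeg _ _)) = _
      rw [HomogeneousLocalization.val_mk, RingHom.comp_apply, ← Localization.mk_one_eq_algebraMap]
      rfl
    apply HomogeneousLocalization.val_injective
    change algebraMap A L _ = (HomogeneousLocalization.Away.mk (grading R) (X_mem R i) n a ha).val
    rw [MvPolynomial.hom_eval₂, hι]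
    simp only [hval]
    rw [smul_eq_mul, mul_one] at ha
    -- Evaluating `a` at the fractions `x_j / x_i` gives `a / x_i^n` by homogeneity; here `c` stands
    -- for `1 / x_i`.
    rw [eval₂_mul_of_mem_grading _ _ _ ha]
    have : MvPolynomial.eval₂ ((algebraMap (MvPolynomial (Fin 2) R) L).comp MvPolynomial.C)
        (fun j => algebraMap (MvPolynomial (Fin 2) R) L (MvPolynomial.X j)) a = algebraMap (MvPolynomial (Fin 2) R) L a := by
      rw [← MvPolynomial.hom_eval₂, MvPolynomial.eval₂_eta]
    rw [this, HomogeneousLocalization.Away.val_mk, ← Localization.mk_one_eq_algebraMap,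
      Localization.mk_pow, Localization.mk_mul]
    simp only [one_pow, one_mul, mul_one]
    rfl
  · refine Function.RightInverse.surjective (g := ψ) fun z => ?_
    have : (awayEval Polynomial.C (coord R i) (MvPolynomial.X i) hi).comp ψ = RingHom.id _ := by
      refine Polynomial.ringHom_ext (fun r => ?_) ?_
      · have h1 := DFunLike.congr_fun (awayEval_comp_algebraMap _ _ hi (X_mem R i)) r
        have h2 := DFunLike.congr_fun hψC r
        rw [RingHom.comp_apply, RingHom.id_apply]
        exact (congrArg _ h2).trans h1
      · rw [RingHom.comp_apply, hψX, hev, RingHom.id_apply, coord, if_neg]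
        lia
    exact DFunLike.congr_fun this z

instance isOpenImmersion_chart (i : Fin 2) : IsOpenImmersion (chart R i) := by
  have : IsIso (CommRingCat.ofHom (awayEval Polynomial.C (coord R i) (MvPolynomial.X i)
      (by simp [coord]))) :=
    (RingEquiv.ofBijective _ (awayEval_coord_bijective i (by simp [coord]))).toCommRingCatIso.isIso_hom
  unfold chart point
  infer_instance

lemma opensRange_chart (i : Fin 2) :
    (chart R i).opensRange = Proj.basicOpen (grading R) (MvPolynomial.X i) := by
  have : IsIso (CommRingCat.ofHom (awayEval Polynomial.C (coord R i) (MvPolynomial.X i)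
      (by simp [coord]))) :=
    (RingEquiv.ofBijective _ (awayEval_coord_bijective i (by simp [coord]))).toCommRingCatIso.isIso_hom
  rw [← Proj.opensRange_awayι (grading R) (MvPolynomial.X i) (X_mem R i) one_pos]
  exact Scheme.Hom.opensRange_comp_of_isIso ..

/-- The cover of `ℙ¹` by its two standard charts. -/
def chartCover (R : Type u) [CommRing R] : (ProjLine R).OpenCover where
  I₀ := Fin 2
  X _ := Spec (.of R[X])
  f i := chart R i
  mem₀ := by
    rw [Scheme.presieve₀_mem_precoverage_iff]
    refine ⟨fun z => ?_, fun i => isOpenImmersion_chart (R := R) i⟩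
    obtain ⟨i, y, rfl⟩ := (cover R).openCover.exists_eq z
    change Fin 2 at i
    have h : (cover R).openCover.f i y ∈ (chart R i).opensRange := by
      rw [opensRange_chart, ← Proj.opensRange_awayι (grading R) _ (X_mem R i) one_pos]
      exact ⟨y, rfl⟩
    exact ⟨i, h⟩

lemma chart_toSpec (i : Fin 2) :
    chart R i ≫ toSpec R = Spec.map (CommRingCat.ofHom Polynomial.C) :=
  point_toSpec ..

lemma chart_map (φ : R →+* S) (i : Fin 2) :
    chart S i ≫ map φ 1 =
      Spec.map (CommRingCat.ofHom (Polynomial.mapRingHom φ)) ≫ chart R i := by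
  have hX : MvPolynomial.X i = linSubst φ (1 : GL (Fin 2) S).1 (MvPolynomial.X i) := by
    fin_cases i <;> simp [Fin.sum_univ_two]
  rw [chart, point_congr one_pos _ _ rfl rfl hX, ← linMap_one,
    point_linMap φ 1 Polynomial.C (coord S i) one_pos (X_mem R i), chart, specMap_point]
  refine point_congr _ _ _ ?_ ?_ rfl
  · ext; simp
  · ext j : 1
    fin_cases i <;> fin_cases j <;> simp [coord, Matrix.map_one]

lemma isPullback_chart (φ : R →+* S) (i : Fin 2) :
    IsPullback (Spec.map (CommRingCat.ofHom (Polynomial.mapRingHom φ))) (chart S i) (chart R i)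
      (map φ 1) := by
  refine IsOpenImmersion.isPullback _ _ _ _ (chart_map φ i) ?_
  rw [opensRange_chart, opensRange_chart]
  change Proj.basicOpen (grading S) (subst φ 1 (MvPolynomial.X i)) = _
  rw [subst_one, MvPolynomial.map_X]

lemma isPullback_specMap_polynomial (φ : R →+* S) :
    IsPullback (Spec.map (CommRingCat.ofHom (Polynomial.mapRingHom φ)))
      (Spec.map (CommRingCat.ofHom Polynomial.C)) (Spec.map (CommRingCat.ofHom Polynomial.C))
      (Spec.map (CommRingCat.ofHom φ)) := by
  algebraize [φ, Polynomial.mapRingHom φ]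
  exact (isPullback_SpecMap_of_isPushout _ _ _ _
    (CommRingCat.isPushout_of_isPushout R S R[X] S[X])).flip

/-- The formation of `ℙ¹` commutes with base change. -/
lemma isPullback_map_one (φ : R →+* S) :
    IsPullback (map φ 1) (toSpec S) (toSpec R) (Spec.map (CommRingCat.ofHom φ)) := by
  refine isPullback_of_openCover (map_toSpec φ 1) (chartCover R) (fun _ => Spec (.of S[X]))
    (fun i => chart S i) (fun _ => Spec.map (CommRingCat.ofHom (Polynomial.mapRingHom φ)))
    (fun i => isPullback_chart φ i) fun i => ?_
  change Fin 2 at i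
  change IsPullback _ (chart S i ≫ toSpec S) (chart R i ≫ toSpec R) _
  rw [chart_toSpec, chart_toSpec]
  exact isPullback_specMap_polynomial φ

lemma isPullback_linMap (φ : R →+* S) (M : GL (Fin 2) S) :
    IsPullback (linMap φ M) (toSpec S) (toSpec R) (Spec.map (CommRingCat.ofHom φ)) := by
  have h : IsPullback (linMap (RingHom.id S) M) (toSpec S) (toSpec S) (𝟙 _) :=
    IsPullback.of_horiz_isIso ⟨by
      rw [linMap_toSpec, CommRingCat.ofHom_id, Spec.map_id]⟩
  have := h.paste_horiz (isPullback_map_one φ)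
  rwa [← linMap_eq_comp, Category.id_comp] at this

/-- `linMap φ M` is a base change of the inclusion of the open set `D(f)`, so its image is the
preimage of `D(f)`. -/
lemma range_linMap (φ : R →+* S) (M : GL (Fin 2) S) (f : R)
    (h : letI := φ.toAlgebra; IsLocalization.Away f S) :
    Set.range (linMap φ M) = toSpec R ⁻¹' (PrimeSpectrum.basicOpen f : Set (PrimeSpectrum R)) := by
  let := φ.toAlgebra
  rw [← PrimeSpectrum.localization_away_comap_range S f,
    ← (isPullback_linMap φ M).isoPullback_hom_fst, Scheme.Hom.comp_base, TopCat.coe_comp,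
    Set.range_comp, Set.range_eq_univ.mpr (Scheme.Hom.surjective _), Set.image_univ,
    Scheme.Pullback.range_fst]
  rfl

instance smoothOfRelativeDimension_toSpec : SmoothOfRelativeDimension 1 (toSpec R) := by
  have : IsZariskiLocalAtSource (@SmoothOfRelativeDimension.{u} 1) :=
    HasRingHomProperty.instIsZariskiLocalAtSource
  rw [IsZariskiLocalAtSource.iff_of_openCover (P := @SmoothOfRelativeDimension 1) (chartCover R)]
  intro i
  change Fin 2 at i
  change SmoothOfRelativeDimension 1 (chart R i ≫ toSpec R)
  rw [chart_toSpec, HasRingHomProperty.Spec_iff (P := @SmoothOfRelativeDimension 1)]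
  refine RingHom.locally_of RingHom.isStandardSmoothOfRelativeDimension_respectsIso _ ?_
  have : Algebra.IsStandardSmoothOfRelativeDimension 1 R R[X] := inferInstance
  exact (RingHom.isStandardSmoothOfRelativeDimension_algebraMap 1).mpr this

/-- `Proj` is proper over the spectrum of its degree-zero part; this identifies that part with `R`.
-/
lemma algebraMap_grading_zero_bijective : Function.Bijective (algebraMap R (grading R 0)) := by
  constructor
  · intro r s h
    exact MvPolynomial.C_injective (Fin 2) R congr(($h).1)
  · rintro ⟨p, hp⟩
    refine ⟨MvPolynomial.coeff 0 p, Subtype.ext ?_⟩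
    exact (MvPolynomial.totalDegree_eq_zero_iff_eq_C.mp
      (MvPolynomial.IsHomogeneous.totalDegree_le (n := 0) hp |> Nat.le_zero.mp)).symm

instance isProper_toSpec : IsProper (toSpec R) := by
  have : IsIso (CommRingCat.ofHom (algebraMap R (grading R 0))) :=
    (RingEquiv.ofBijective _ algebraMap_grading_zero_bijective).toCommRingCatIso.isIso_hom
  have : IsScalarTower R (grading R 0) (MvPolynomial (Fin 2) R) :=
    ⟨fun r a p => Algebra.smul_mul_assoc r a.1 p⟩
  have : Algebra.FiniteType (grading R 0) (MvPolynomial (Fin 2) R) :=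
    .of_restrictScalars_finiteType R _ _
  unfold toSpec
  infer_instance

end ProjLine

/-! ### Laurent polynomials and the coordinate `s⁻¹` -/

namespace LaurentPolynomial

variable {R S : Type u} [CommRing R] [CommRing S]

/-- The inclusion `R[s⁻¹] → R[s, s⁻¹]`. -/
def toLaurentInv (R : Type u) [CommRing R] : R[X] →+* R[T;T⁻¹] :=
  (invert (R := R) : R[T;T⁻¹] →+* R[T;T⁻¹]).comp Polynomial.toLaurent

@[simp] lemma toLaurentInv_C (r : R) : toLaurentInv R (Polynomial.C r) = C r := by
  simp [toLaurentInv]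

@[simp] lemma toLaurentInv_X : toLaurentInv R Polynomial.X = T (-1) := by
  simp [toLaurentInv]

lemma isLocalization_toLaurentInv :
    letI := (toLaurentInv R).toAlgebra
    IsLocalization.Away (Polynomial.X : R[X]) R[T;T⁻¹] := by
  -- The two algebra structures send the variable to `s` and to `s⁻¹`; inversion is an isomorphism
  -- between them.
  let a₁ : Algebra R[X] R[T;T⁻¹] := inferInstance
  let a₂ := (toLaurentInv R).toAlgebra
  exact @IsLocalization.isLocalization_of_algEquiv _ _ _ _ _ a₁ _ _ a₂ isLocalization
    (@AlgEquiv.ofRingEquiv _ _ _ _ _ _ a₁ a₂ (invert (R := R)).toRingEquiv fun _ => rfl)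

/-- The map of Laurent polynomial rings induced by a map of coefficient rings. -/
def mapHom (φ : R →+* S) : R[T;T⁻¹] →+* S[T;T⁻¹] :=
  AddMonoidAlgebra.mapRingHom ℤ φ

@[simp] lemma mapHom_C (φ : R →+* S) (r : R) : mapHom φ (C r) = C (φ r) :=
  AddMonoidAlgebra.mapRingHom_single ..

@[simp] lemma mapHom_T (φ : R →+* S) (n : ℤ) : mapHom φ (T n) = T n := by
  refine (AddMonoidAlgebra.mapRingHom_single ..).trans ?_
  rw [map_one]
  rfl

lemma mapHom_comp_toLaurent (φ : R →+* S) :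
    (mapHom φ).comp Polynomial.toLaurent =
      (Polynomial.toLaurent (R := S)).comp (Polynomial.mapRingHom φ) := by
  refine Polynomial.ringHom_ext (fun r => ?_) ?_ <;> simp

lemma mapHom_comp_toLaurentInv (φ : R →+* S) :
    (mapHom φ).comp (toLaurentInv R) = (toLaurentInv S).comp (Polynomial.mapRingHom φ) := by
  refine Polynomial.ringHom_ext (fun r => ?_) ?_ <;> simp

end LaurentPolynomial

open LaurentPolynomial ProjLine

/-! ### Ruled surfaces from a transition matrix -/

namespace Ruled

variable {R S : Type u} [CommRing R] [CommRing S]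

/-- The open immersion `𝔾ₘ × ℙ¹ → 𝔸¹ × ℙ¹`, `(s, x) ↦ (s⁻¹, M(s) x)` (over `R`). -/
def glueRight (M : GL (Fin 2) R[T;T⁻¹]) : ProjLine R[T;T⁻¹] ⟶ ProjLine R[X] :=
  linMap (toLaurentInv R) M

instance (M : GL (Fin 2) R[T;T⁻¹]) : IsOpenImmersion (glueRight M) :=
  isOpenImmersion_linMap _ _ Polynomial.X isLocalization_toLaurentInv

end Ruled

/-- The `ℙ¹`-bundle over `ℙ¹_R` obtained from two copies of `𝔸¹ × ℙ¹` by gluing `(s, x)`, `s ≠ 0`,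
in the first copy with `(s⁻¹, M(s) x)` in the second. -/
def Ruled {R : Type u} [CommRing R] (M : GL (Fin 2) R[T;T⁻¹]) : Scheme.{u} :=
  pushout (Hirzebruch.glueLeft R) (Ruled.glueRight M)

namespace Ruled

variable {R S : Type u} [CommRing R] [CommRing S]

section

variable (M : GL (Fin 2) R[T;T⁻¹])

/-- The first copy of `𝔸¹ × ℙ¹`. -/
def inl : ProjLine R[X] ⟶ Ruled M := pushout.inl _ _

/-- The second copy of `𝔸¹ × ℙ¹`. -/
def inr : ProjLine R[X] ⟶ Ruled M := pushout.inr _ _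

instance : IsOpenImmersion (inl M) := isOpenImmersion_pushout_inl _ _

instance : IsOpenImmersion (inr M) := isOpenImmersion_pushout_inr _ _

variable {M} in
lemma hom_ext {Z : Scheme.{u}} {f g : Ruled M ⟶ Z} (hl : inl M ≫ f = inl M ≫ g)
    (hr : inr M ≫ f = inr M ≫ g) : f = g :=
  pushout.hom_ext hl hr

/-- The open cover of a ruled surface by two copies of `𝔸¹ × ℙ¹`. -/
def cover : (Ruled M).OpenCover :=
  pairCover (inl M) (inr M) (pushout_jointly_surjective _ _)

lemma glueLeft_eq : Hirzebruch.glueLeft R = linMap Polynomial.toLaurent 1 :=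
  (linMap_one _).symm

lemma range_glueLeft : Set.range (Hirzebruch.glueLeft R) =
    ProjLine.toSpec R[X] ⁻¹' (PrimeSpectrum.basicOpen (Polynomial.X : R[X]) : Set (PrimeSpectrum R[X])) := by
  rw [glueLeft_eq]
  exact range_linMap _ _ _ LaurentPolynomial.isLocalization

lemma range_glueRight : Set.range (glueRight M) =
    ProjLine.toSpec R[X] ⁻¹' (PrimeSpectrum.basicOpen (Polynomial.X : R[X]) : Set (PrimeSpectrum R[X])) :=
  range_linMap _ _ _ isLocalization_toLaurentInv

/-- The structure morphism of a ruled surface over `Spec R`. -/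
def toSpec : Ruled M ⟶ Spec (.of R) :=
  pushout.desc
    (ProjLine.toSpec R[X] ≫ Spec.map (CommRingCat.ofHom Polynomial.C))
    (ProjLine.toSpec R[X] ≫ Spec.map (CommRingCat.ofHom Polynomial.C)) <| by
      rw [glueLeft_eq, glueRight, reassoc_of% @linMap_toSpec, reassoc_of% @linMap_toSpec, ← Spec.map_comp,
        ← Spec.map_comp, ← CommRingCat.ofHom_comp, ← CommRingCat.ofHom_comp]
      congr 3
      ext r : 1
      simp

lemma inl_toSpec : inl M ≫ toSpec M =
    ProjLine.toSpec R[X] ≫ Spec.map (CommRingCat.ofHom Polynomial.C) := pushout.inl_desc _ _ _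

lemma inr_toSpec : inr M ≫ toSpec M =
    ProjLine.toSpec R[X] ≫ Spec.map (CommRingCat.ofHom Polynomial.C) := pushout.inr_desc _ _ _

end

/-! ### Base change of ruled surfaces -/

section BaseChange

variable (φ : R →+* S) (M : GL (Fin 2) R[T;T⁻¹])

/-- The base change of a transition matrix. -/
abbrev mapGL : GL (Fin 2) S[T;T⁻¹] := Matrix.GeneralLinearGroup.map (mapHom φ) M

/-- The morphism of ruled surfaces induced by a ring homomorphism. -/
def map : Ruled (mapGL φ M) ⟶ Ruled M :=
  pushout.map _ _ _ _ (ProjLine.map (Polynomial.mapRingHom φ) 1)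
    (ProjLine.map (Polynomial.mapRingHom φ) 1) (ProjLine.map (mapHom φ) 1)
    (by
      rw [glueLeft_eq, glueLeft_eq, ← linMap_one, ← linMap_one, linMap_comp, linMap_comp,
        mapHom_comp_toLaurent]
      simp)
    (by
      rw [glueRight, glueRight, ← linMap_one, ← linMap_one, linMap_comp, linMap_comp,
        mapHom_comp_toLaurentInv]
      simp)

lemma inl_map : inl (mapGL φ M) ≫ map φ M =
    ProjLine.map (Polynomial.mapRingHom φ) 1 ≫ inl M := pushout.inl_desc _ _ _

lemma inr_map : inr (mapGL φ M) ≫ map φ M =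
    ProjLine.map (Polynomial.mapRingHom φ) 1 ≫ inr M := pushout.inr_desc _ _ _

/-- The variable maps to the variable, so the overlap `s ≠ 0` over `S` contains the preimage of the
overlap over `R`. Hence each chart is the full preimage of the corresponding chart. -/
lemma toSpec_mem_basicOpen (y : ↥(ProjLine S[X]))
    (hy : ProjLine.toSpec R[X] (ProjLine.map (Polynomial.mapRingHom φ) 1 y) ∈
      (PrimeSpectrum.basicOpen (Polynomial.X : R[X]) : Set (PrimeSpectrum R[X]))) :
    ProjLine.toSpec S[X] y ∈
      (PrimeSpectrum.basicOpen (Polynomial.X : S[X]) : Set (PrimeSpectrum S[X])) := by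
  rw [← Scheme.Hom.comp_apply, map_toSpec, Scheme.Hom.comp_apply] at hy
  change Polynomial.mapRingHom φ Polynomial.X ∉ (ProjLine.toSpec S[X] y).asIdeal at hy
  rwa [Polynomial.coe_mapRingHom, Polynomial.map_X] at hy

lemma isPullback_inl_map : IsPullback (ProjLine.map (Polynomial.mapRingHom φ) 1)
    (inl (mapGL φ M)) (inl M) (map φ M) := by
  refine isPullback_pushout_inl _ _ _ (inl_map φ M) fun y ⟨x, hx⟩ => ?_
  rw [range_glueRight]
  refine toSpec_mem_basicOpen φ y ?_
  have h : inl M x = inr M (ProjLine.map (Polynomial.mapRingHom φ) 1 y) := by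
    rw [hx, ← Scheme.Hom.comp_apply, ← inr_map]
    rfl
  obtain ⟨u, -, hu⟩ := exists_of_pushout_inl_eq_inr _ _ h
  have : ProjLine.map (Polynomial.mapRingHom φ) 1 y ∈ Set.range (glueRight M) := ⟨u, hu⟩
  rwa [range_glueRight] at this

lemma isPullback_inr_map : IsPullback (ProjLine.map (Polynomial.mapRingHom φ) 1)
    (inr (mapGL φ M)) (inr M) (map φ M) := by
  refine isPullback_pushout_inr _ _ _ (inr_map φ M) fun y ⟨x, hx⟩ => ?_
  rw [range_glueLeft]
  refine toSpec_mem_basicOpen φ y ?_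
  have h : inl M (ProjLine.map (Polynomial.mapRingHom φ) 1 y) = inr M x := by
    rw [hx, ← Scheme.Hom.comp_apply, ← inl_map]
    rfl
  obtain ⟨u, hu, -⟩ := exists_of_pushout_inl_eq_inr _ _ h
  have : ProjLine.map (Polynomial.mapRingHom φ) 1 y ∈ Set.range (Hirzebruch.glueLeft R) := ⟨u, hu⟩
  rwa [range_glueLeft] at this

lemma map_toSpec : map φ M ≫ toSpec M =
    toSpec (mapGL φ M) ≫ Spec.map (CommRingCat.ofHom φ) := by
  have h := (isPullback_specMap_polynomial φ).w
  apply hom_ext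
  · rw [reassoc_of% @inl_map, inl_toSpec, reassoc_of% @inl_toSpec, ← h, ← linMap_one, reassoc_of% @linMap_toSpec]
  · rw [reassoc_of% @inr_map, inr_toSpec, reassoc_of% @inr_toSpec, ← h, ← linMap_one, reassoc_of% @linMap_toSpec]

/-- The formation of ruled surfaces commutes with base change. -/
lemma isPullback_map :
    IsPullback (map φ M) (toSpec (mapGL φ M)) (toSpec M) (Spec.map (CommRingCat.ofHom φ)) := by
  have h := (isPullback_map_one (Polynomial.mapRingHom φ)).paste_vert
    (isPullback_specMap_polynomial φ)
  refine isPullback_of_openCover (map_toSpec φ M) (cover M) (fun _ => ProjLine S[X])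
    (fun b => match b with
      | ⟨true⟩ => inl _
      | ⟨false⟩ => inr _)
    (fun b => match b with
      | ⟨true⟩ => ProjLine.map (Polynomial.mapRingHom φ) 1
      | ⟨false⟩ => ProjLine.map (Polynomial.mapRingHom φ) 1) ?_ ?_
  · rintro ⟨_ | _⟩
    · exact isPullback_inr_map φ M
    · exact isPullback_inl_map φ M
  · rintro ⟨_ | _⟩
    · change IsPullback _ (inr _ ≫ toSpec _) (inr _ ≫ toSpec _) _
      rwa [inr_toSpec, inr_toSpec]
    · change IsPullback _ (inl _ ≫ toSpec _) (inl _ ≫ toSpec _) _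
      rwa [inl_toSpec, inl_toSpec]

end BaseChange

end Ruled

/-! ### The overlap of the two charts of `ℙ¹` -/

namespace ProjLine

variable {R : Type u} [CommRing R]

/-- The two charts give `[1 : s]` and `[s⁻¹ : 1]` on the overlap, which differ by the scalar `s⁻¹`.
This lets the projection to `ℙ¹` be glued. -/
lemma specMap_chart_zero_eq_one :
    Spec.map (CommRingCat.ofHom Polynomial.toLaurent) ≫ chart R 0 =
      Spec.map (CommRingCat.ofHom (toLaurentInv R)) ≫ chart R 1 := by
  have hφ : (toLaurentInv R).comp Polynomial.C = Polynomial.toLaurent.comp Polynomial.C := by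
    ext r : 1
    simp
  have hy : toLaurentInv R ∘ coord R 1 =
      fun j => T (-1) * (Polynomial.toLaurent ∘ coord R 0) j := by
    ext1 j
    obtain rfl | rfl : j = 0 ∨ j = 1 := by lia
    · simp [coord]
    · simp only [coord, Function.comp_apply, if_true, map_one, one_ne_zero, if_false,
        Polynomial.toLaurent_X]
      rw [← T_add, neg_add_cancel, T_zero]
  have h1 : IsUnit (MvPolynomial.eval₂ ((Polynomial.toLaurent (R := R)).comp Polynomial.C)
      (Polynomial.toLaurent ∘ coord R 0) (MvPolynomial.X 1)) := by
    simpa [coord] using isUnit_T 1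
  rw [chart, chart, specMap_point, specMap_point, point_congr one_pos _ _ hφ hy rfl,
    point_smul _ _ _ _ _ h1]
  exact point_eq_point ..

/-- The locus where `x_j` is invertible meets the `i`-th chart where `x_j / x_i` is invertible, and
that fraction is the chart's coordinate. -/
lemma mem_basicOpen_of_chart_mem_range {i j : Fin 2} (hij : i ≠ j) (x : ↥(Spec (.of R[X])))
    (hx : chart R i x ∈ Set.range (chart R j)) :
    x ∈ (PrimeSpectrum.basicOpen (Polynomial.X : R[X]) : Set (PrimeSpectrum R[X])) := by
  have h : chart R i x ∈ (chart R j).opensRange := hx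
  rw [opensRange_chart, chart, point, Scheme.Hom.comp_apply] at h
  have h2 := (Proj.awayι_preimage_basicOpen (grading R) (X_mem R i) one_pos (X_mem R j) one_pos).le h
  change awayEval _ _ _ _ (HomogeneousLocalization.Away.isLocalizationElem (X_mem R i) (X_mem R j)) ∉
    x.asIdeal at h2
  have hev := awayEval_mk Polynomial.C (coord R i) (by simp [coord]) (X_mem R i) 1
    (MvPolynomial.X j ^ 1) (by simpa using X_mem R j)
  simp only [MvPolynomial.eval₂_X, coord, if_true, if_neg hij.symm, mul_one, pow_one] at hev
  exact fun hX => h2 (by simpa only [HomogeneousLocalization.Away.isLocalizationElem, pow_one, hev] using hX)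

end ProjLine

/-! ### The projection to `ℙ¹`; smoothness and properness -/

namespace Ruled

variable {R S : Type u} [CommRing R] [CommRing S]

section ToLine

variable (M : GL (Fin 2) R[T;T⁻¹])

/-- The projection of a ruled surface to `ℙ¹`. -/
def toLine : Ruled M ⟶ ProjLine R :=
  pushout.desc (ProjLine.toSpec R[X] ≫ chart R 0) (ProjLine.toSpec R[X] ≫ chart R 1) <| by
    rw [glueLeft_eq, glueRight, reassoc_of% @linMap_toSpec, reassoc_of% @linMap_toSpec, specMap_chart_zero_eq_one]

lemma inl_toLine : inl M ≫ toLine M = ProjLine.toSpec R[X] ≫ chart R 0 := pushout.inl_desc _ _ _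

lemma inr_toLine : inr M ≫ toLine M = ProjLine.toSpec R[X] ≫ chart R 1 := pushout.inr_desc _ _ _

lemma isPullback_inl_toLine :
    IsPullback (ProjLine.toSpec R[X]) (inl M) (chart R 0) (toLine M) := by
  refine isPullback_pushout_inl _ _ _ (inl_toLine M) fun y hy => ?_
  rw [range_glueRight]
  change (inr M ≫ toLine M) y ∈ _ at hy
  rw [inr_toLine] at hy
  exact mem_basicOpen_of_chart_mem_range one_ne_zero _ hy

lemma isPullback_inr_toLine :
    IsPullback (ProjLine.toSpec R[X]) (inr M) (chart R 1) (toLine M) := by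
  refine isPullback_pushout_inr _ _ _ (inr_toLine M) fun y hy => ?_
  rw [range_glueLeft]
  change (inl M ≫ toLine M) y ∈ _ at hy
  rw [inl_toLine] at hy
  exact mem_basicOpen_of_chart_mem_range zero_ne_one _ hy

lemma toLine_toSpec : toLine M ≫ ProjLine.toSpec R = toSpec M := by
  apply hom_ext
  · rw [reassoc_of% inl_toLine M, inl_toSpec, chart_toSpec]
  · rw [reassoc_of% inr_toLine M, inr_toSpec, chart_toSpec]

/-- Over each standard chart of the base `ℙ¹` the projection is the trivial bundle `ℙ¹ × 𝔸¹ → 𝔸¹`.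
This serves for both properness and smoothness. -/
lemma toLine_of_isZariskiLocalAtTarget (P : MorphismProperty Scheme.{u}) [IsZariskiLocalAtTarget P]
    (h : P (ProjLine.toSpec R[X])) : P (toLine M) := by
  refine IsZariskiLocalAtTarget.of_openCover (chartCover R) fun i => ?_
  change Fin 2 at i
  change P (pullback.snd (toLine M) (chart R i))
  obtain rfl | rfl : i = 0 ∨ i = 1 := by lia
  · rwa [← (isPullback_inl_toLine M).flip.isoPullback_inv_snd, P.cancel_left_of_respectsIso]
  · rwa [← (isPullback_inr_toLine M).flip.isoPullback_inv_snd, P.cancel_left_of_respectsIso]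

instance isProper_toSpec : IsProper (toSpec M) := by
  have : IsProper (toLine M) := toLine_of_isZariskiLocalAtTarget M @IsProper
    ProjLine.isProper_toSpec
  rw [← toLine_toSpec]
  infer_instance

instance smoothOfRelativeDimension_toSpec : SmoothOfRelativeDimension 2 (toSpec M) := by
  have : IsZariskiLocalAtTarget (@SmoothOfRelativeDimension.{u} 1) :=
    HasRingHomProperty.instIsZariskiLocalAtTarget _
  have : SmoothOfRelativeDimension 1 (toLine M) :=
    toLine_of_isZariskiLocalAtTarget M (@SmoothOfRelativeDimension 1)
      ProjLine.smoothOfRelativeDimension_toSpec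
  rw [← toLine_toSpec]
  exact smoothOfRelativeDimension_comp 1 1 _ _

end ToLine

/-! ### Equivalent transition matrices -/

section Equivalence

variable {M M' : GL (Fin 2) R[T;T⁻¹]} (A B : GL (Fin 2) R[X]) (w : (R[T;T⁻¹])ˣ)
  (h : Matrix.GeneralLinearGroup.map (toLaurentInv R) B * M =
    scalarGL w * (M' * Matrix.GeneralLinearGroup.map Polynomial.toLaurent A))

/-- A scalar commutes with `M`, so it can be moved to the source, where it acts as the identity. -/
lemma linMap_comp_scalarGL_mul (φ : R →+* S) (M : GL (Fin 2) S) (w : Sˣ) :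
    linMap φ (scalarGL w * M) = linMap φ M := by
  have hc : scalarGL w * M = M * scalarGL w := by
    refine Units.ext ?_
    exact (Matrix.scalar_commute (w : S) (fun _ => mul_comm _ _) M.1).eq
  have := linMap_comp φ M (RingHom.id S) (scalarGL w)
  rw [linMap_scalarGL, Category.id_comp, RingHom.id_comp] at this
  rw [this, hc]
  rfl

/-- Changing the trivialisations on the two charts, and the transition matrix by a scalar, does not
change a ruled surface. -/
def isoOfEquiv : Ruled M ≅ Ruled M' :=
  have hl : Hirzebruch.glueLeft R ≫ linMap (RingHom.id _) A =
      linMap (RingHom.id _) (Matrix.GeneralLinearGroup.map (Polynomial.toLaurent (R := R)) A) ≫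
        Hirzebruch.glueLeft R := by
    rw [glueLeft_eq, linMap_comp, linMap_comp]
    simp
  -- This is `h` read projectively: `A` acts in the coordinate `s`, `B` in the coordinate `s⁻¹`, and
  -- the scalar `w` disappears.
  have hr : glueRight M ≫ linMap (RingHom.id _) B =
      linMap (RingHom.id _) (Matrix.GeneralLinearGroup.map (Polynomial.toLaurent (R := R)) A) ≫
        glueRight M' := by
    rw [glueRight, glueRight, linMap_comp, linMap_comp, h, RingHom.comp_id, RingHom.id_comp,
      linMap_comp_scalarGL_mul]
    rfl
  let f : Ruled M ⟶ Ruled M' := pushout.map _ _ _ _ _ _ _ hl hr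
  have : IsIso f := pushout.map_isIso ..
  asIso f

lemma inl_isoOfEquiv : inl M ≫ (isoOfEquiv A B w h).hom = linMap (RingHom.id _) A ≫ inl M' :=
  pushout.inl_desc _ _ _

lemma inr_isoOfEquiv : inr M ≫ (isoOfEquiv A B w h).hom = linMap (RingHom.id _) B ≫ inr M' :=
  pushout.inr_desc _ _ _

lemma isoOfEquiv_toSpec : (isoOfEquiv A B w h).hom ≫ toSpec M' = toSpec M := by
  apply hom_ext
  · rw [reassoc_of% inl_isoOfEquiv A B w h, inl_toSpec, inl_toSpec, reassoc_of% @linMap_toSpec]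
    simp
  · rw [reassoc_of% inr_isoOfEquiv A B w h, inr_toSpec, inr_toSpec, reassoc_of% @linMap_toSpec]
    simp

end Equivalence

end Ruled

/-! ### Hirzebruch surfaces as ruled surfaces -/

namespace Hirzebruch

variable (R : Type u) [CommRing R] (a : ℕ)

lemma glueRight_eq : glueRight R a = Ruled.glueRight (diagGL (powUnit R a)) :=
  (linMap_diagGL _ _).symm

/-- The Hirzebruch surface `𝔽_a` is the ruled surface with transition matrix `diag(1, s ^ a)`. -/
def isoRuled : Ruled (diagGL (powUnit R a)) ≅ Hirzebruch R a :=
  pushout.congrHom rfl (glueRight_eq R a).symm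

lemma inl_isoRuled : Ruled.inl (diagGL (powUnit R a)) ≫ (isoRuled R a).hom =
    pushout.inl (glueLeft R) (glueRight R a) := by
  refine (pushout.inl_desc _ _ _).trans (Category.id_comp _)

lemma inr_isoRuled : Ruled.inr (diagGL (powUnit R a)) ≫ (isoRuled R a).hom =
    pushout.inr (glueLeft R) (glueRight R a) := by
  refine (pushout.inr_desc _ _ _).trans (Category.id_comp _)

lemma isoRuled_toSpec :
    (isoRuled R a).hom ≫ toSpec R a = Ruled.toSpec (diagGL (powUnit R a)) := by
  apply Ruled.hom_ext
  · rw [reassoc_of% inl_isoRuled R a, Ruled.inl_toSpec]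
    exact pushout.inl_desc _ _ _
  · rw [reassoc_of% inr_isoRuled R a, Ruled.inr_toSpec]
    exact pushout.inr_desc _ _ _

end Hirzebruch

/-! ### The extension matrix and its splitting -/

namespace Ruled

variable {R S : Type u} [CommRing R] [CommRing S]

/-- The matrix `[1, 0; t s ^ n, s ^ m]`, the transition matrix of an extension of line bundles. -/
def extGL (t : R) (n m : ℕ) : GL (Fin 2) R[T;T⁻¹] :=
  Matrix.GeneralLinearGroup.mk'' !![1, 0; C t * T n, T m] (by simpa using isUnit_T _)

lemma coe_extGL (t : R) (n m : ℕ) :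
    (extGL t n m).1 = !![1, 0; C t * T n, T m] := rfl

lemma coe_diagGL (w : Rˣ) : (diagGL w).1 = !![1, 0; 0, (w : R)] := by
  change Matrix.diagonal ![1, (w : R)] = _
  ext i j
  fin_cases i <;> fin_cases j <;> simp

lemma mapGL_extGL (φ : R →+* S) (t : R) (n m : ℕ) :
    mapGL φ (extGL t n m) = extGL (φ t) n m := by
  refine Units.ext ?_
  change (extGL t n m).1.map (mapHom φ) = _
  rw [coe_extGL, coe_extGL]
  ext i j
  fin_cases i <;> fin_cases j <;> simp

lemma extGL_zero (n m : ℕ) : extGL (0 : R) n m = diagGL (Hirzebruch.powUnit R m) := by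
  refine Units.ext ?_
  rw [coe_extGL, coe_diagGL, map_zero, zero_mul]
  rfl

/-- For an invertible extension class, the ruled surface is a split one. -/
lemma exists_iso_extGL (t : Rˣ) (n e : ℕ) :
    ∃ i : Ruled (extGL (t : R) n (2 * n + e)) ≅ Ruled (diagGL (Hirzebruch.powUnit R e)),
      i.hom ≫ toSpec _ = toSpec _ := by
  -- `B` moves the row `(t s^n, s^(2n+e)) = s^n (t, s^(n+e))` to the top and subtracts `t⁻¹ s⁻ⁿ`
  -- times it from `(1, 0)`, leaving `(0, -t⁻¹ s^(n+e))`. Extracting `s^n · diag(1, s^e)` leaves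
  -- `A`, which is polynomial in `s`. The factor `s⁻ⁿ` is polynomial in the second chart's
  -- coordinate, hence `X ^ n` in `B`. Both determinants are `-1`.
  let A : GL (Fin 2) R[X] := Matrix.GeneralLinearGroup.mk''
    !![Polynomial.C (t : R), Polynomial.X ^ (n + e); 0, -Polynomial.C (t⁻¹ : Rˣ).1]
    (by
      rw [Matrix.det_fin_two_of, mul_zero, sub_zero, mul_neg, ← Polynomial.C_mul, Units.mul_inv]
      simp)
  let B : GL (Fin 2) R[X] := Matrix.GeneralLinearGroup.mk''
    !![0, 1; 1, -(Polynomial.C (t⁻¹ : Rˣ).1 * Polynomial.X ^ n)]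
    (by simp [Matrix.det_fin_two_of])
  have h : Matrix.GeneralLinearGroup.map (toLaurentInv R) B * extGL (t : R) n (2 * n + e) =
      scalarGL (Hirzebruch.powUnit R n) * (diagGL (Hirzebruch.powUnit R e) *
        Matrix.GeneralLinearGroup.map (Polynomial.toLaurent (R := R)) A) := by
    refine Units.ext ?_
    have hB : (Matrix.GeneralLinearGroup.map (toLaurentInv R) B).1 =
        !![0, 1; 1, -(C (t⁻¹ : Rˣ).1 * T (-n))] := by
      change (!![0, 1; 1, -(Polynomial.C (t⁻¹ : Rˣ).1 * Polynomial.X ^ n)] : Matrix _ _ _).map _ = _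
      ext i j : 1
      fin_cases i <;> fin_cases j <;> simp [T_pow]
    have hA : (Matrix.GeneralLinearGroup.map (Polynomial.toLaurent (R := R)) A).1 =
        !![C (t : R), T (n + e); 0, -C (t⁻¹ : Rˣ).1] := by
      change (!![Polynomial.C (t : R), Polynomial.X ^ (n + e); 0,
        -Polynomial.C (t⁻¹ : Rˣ).1] : Matrix _ _ _).map _ = _
      ext i j : 1
      fin_cases i <;> fin_cases j <;> simp
    have hw : (scalarGL (Hirzebruch.powUnit R n)).1 = !![T n, 0; 0, T n] := by
      change Matrix.scalar _ (T n) = _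
      ext i j : 1
      fin_cases i <;> fin_cases j <;> simp
    have ht : (C (t⁻¹ : Rˣ).1 : R[T;T⁻¹]) * C (t : R) = 1 := by
      rw [← map_mul, Units.inv_mul, map_one]
    have hT : (T (-n) : R[T;T⁻¹]) * T n = 1 := by
      rw [← T_add, neg_add_cancel, T_zero]
    have hm : (T ((2 * n + e : ℕ) : ℤ) : R[T;T⁻¹]) = T n * T (n + e) := by
      rw [← T_add]
      congr 1
      push_cast
      ring
    have hne : (T ((n : ℤ) + e) : R[T;T⁻¹]) = T n * T e := T_add _ _
    have hd : ((Hirzebruch.powUnit R e : (R[T;T⁻¹])ˣ) : R[T;T⁻¹]) = T e := rfl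
    simp only [Units.val_mul, hB, hA, hw, coe_extGL, coe_diagGL, hm, hd]
    rw [Matrix.mul_fin_two, Matrix.mul_fin_two, Matrix.mul_fin_two]
    ext i j : 1
    fin_cases i <;> fin_cases j <;> simp only [Matrix.of_apply, Matrix.cons_val', Matrix.cons_val_zero,
      Matrix.cons_val_one, Fin.zero_eta, Fin.mk_one, Matrix.empty_val', Matrix.cons_val_fin_one]
    · ring
    · ring
    · linear_combination (-T (-n) * T n) * ht - hT
    · linear_combination (-C (t⁻¹ : Rˣ).1 * T (n + e)) * hT - C (t⁻¹ : Rˣ).1 * hne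
  exact ⟨isoOfEquiv A B _ h, isoOfEquiv_toSpec A B _ h⟩

end Ruled

/-- By base change the fibre over `c` is the ruled surface whose matrix has `t` replaced by `c`, so
only that matrix has to be recognized. -/
lemma fibreIsHirzebruch_of_iso {K : Type} [Field K] [Algebra ℂ K] (c : K) (a : ℕ) (n m : ℕ)
    (h : ∃ i : Ruled (Ruled.extGL c n m) ≅ Ruled (diagGL (Hirzebruch.powUnit K a)),
      i.hom ≫ Ruled.toSpec _ = Ruled.toSpec _) :
    FibreIsHirzebruch (Ruled.toSpec (Ruled.extGL (Polynomial.X : ℂ[X]) n m)) c a := by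
  let φ : ℂ[X] →+* K := (Polynomial.aeval (R := ℂ) c : ℂ[X] →+* K)
  have hφ : Ruled.mapGL φ (Ruled.extGL (Polynomial.X : ℂ[X]) n m) = Ruled.extGL c n m := by
    rw [Ruled.mapGL_extGL]
    simp [φ]
  rw [← hφ] at h
  obtain ⟨i, hi⟩ := h
  have hp := Ruled.isPullback_map φ (Ruled.extGL (Polynomial.X : ℂ[X]) n m)
  refine ⟨Over.isoMk (hp.isoPullback.symm ≪≫ i ≪≫ Hirzebruch.isoRuled K a) ?_⟩
  change (hp.isoPullback.inv ≫ i.hom ≫ (Hirzebruch.isoRuled K a).hom) ≫ Hirzebruch.toSpec K a = _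
  rw [Category.assoc, Category.assoc, Hirzebruch.isoRuled_toSpec, hi]
  exact hp.isoPullback_inv_snd

lemma exists_degeneration (n e : ℕ) :
    ∃ (F : Scheme.{0}) (π : F ⟶ Spec (.of ℂ[X])),
      IsProper π ∧ SmoothOfRelativeDimension 2 π ∧
      FibreIsHirzebruch π (0 : ℂ) (2 * n + e) ∧
      ∀ (K : Type) [Field K] [Algebra ℂ K] (c : K), c ≠ 0 → FibreIsHirzebruch π c e := by
  -- The extension class is the coordinate `t` of the base: at `0` the matrix is already diagonal,
  -- and at `c ≠ 0` the class is a unit of `K`.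
  refine ⟨_, Ruled.toSpec (Ruled.extGL (Polynomial.X : ℂ[X]) n (2 * n + e)), inferInstance,
    inferInstance, fibreIsHirzebruch_of_iso _ _ _ _ ?_, fun K _ _ c hc =>
      fibreIsHirzebruch_of_iso _ _ _ _ (Ruled.exists_iso_extGL (Units.mk0 c hc) n e)⟩
  rw [Ruled.extGL_zero]
  exact ⟨Iso.refl _, Category.id_comp _⟩

end

theorem mainTheorem8 (n : ℕ) :
    (∃ (F : Scheme.{0}) (π : F ⟶ Spec (.of ℂ[X])),
      IsProper π ∧ SmoothOfRelativeDimension 2 π ∧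
      FibreIsHirzebruch π (0 : ℂ) (2 * n) ∧
      ∀ (K : Type) [Field K] [Algebra ℂ K] (c : K), c ≠ 0 → FibreIsHirzebruch π c 0) ∧
    (∃ (F : Scheme.{0}) (π : F ⟶ Spec (.of ℂ[X])),
      IsProper π ∧ SmoothOfRelativeDimension 2 π ∧
      FibreIsHirzebruch π (0 : ℂ) (2 * n + 1) ∧
      ∀ (K : Type) [Field K] [Algebra ℂ K] (c : K), c ≠ 0 → FibreIsHirzebruch π c 1) :=
  ⟨exists_degeneration n 0, exists_degeneration n 1⟩
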